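/- For integers $k\ge 1$ and $n\ge 0$ let $d_k(n)$ denote the number of $k$-elongated plane partition diamonds (of arbitrary finite length) whose links sum to $n$. Here such a diamond is an eventually zero chain of nonnegative integers $$a_0;\ (x_{0,1},y_{0,1}),\dots,(x_{0,k},y_{0,k});\ a_1;\ (x_{1,1},y_{1,1}),\dots,(x_{1,k},y_{1,k});\ a_2;\dots$$ that weakly decreases along the chain, where the two entries of one pair are not compared with each other: for every $i\ge 0$, $a_i\ge x_{i,1},y_{i,1}$; both of $x_{i,s},y_{i,s}$ are $\ge$ both of $x_{i,s+1},y_{i,s+1}$ for $1\le s<k$; and $x_{i,k},y_{i,k}\ge a_{i+1}$. The links are the numbers $a_0,a_1,a_2,\dots$. Equivalently, $$\sum_{n\ge 0} d_k(n)q^n=\prod_{m\ge 1}\frac{(1-q^{2m})^k}{(1-q^m)^{3k+1}}.$$ Write $d_k(An+B_1,B_2,\dots,B_t)\equiv 0 \pmod M$ to mean that $d_k(An+B_i)\equiv 0\pmod M$ for each $i=1,\dots,t$. Then for all integers $j\ge 0$ and $n\ge 0$: \begin{align*} d_{2j+1}(2n+1) &\equiv 0 \pmod{2},\\ d_{3j+2}(3n+2)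 &\equiv 0 \pmod{3},\\ d_{5j+3}(5n+1,3,4) &\equiv 0 \pmod{5},\\ d_{5j+4}(5n+2,3) &\equiv 0 \pmod{5},\\ d_{5j+5}(5n+4) &\equiv 0 \pmod{5},\\ d_{7j+5}(7n+2,3,4,6) &\equiv 0 \pmod{7},\\ d_{7j+6}(7n+3,5,6) &\equiv 0 \pmod{7},\\ d_{7j+7}(7n+5) &\equiv 0 \pmod{7},\\ d_{11j+2}(11n+7) &\equiv 0 \pmod{11},\\ d_{11j+9}(11n+3,5,6,8,9,10) &\equiv 0 \pmod{11},\\ d_{11j+10}(11n+2,6,7,8,10) &\equiv 0 \pmod{11},\\ d_{11j+11}(11n+6) &\equiv 0 \pmod{11},\\ d_{13j+11}(13n+3,4,6,7,8,10,11) &\equiv 0 \pmod{13},\\ d_{13j+12}(13n+2,5,6,7,8,11) &\equiv 0 \pmod{13}. \end{align*} -/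

import Mathlib

/-- A `k`-elongated plane partition diamond of arbitrary (finite) length: a chain of blocks, the
`i`-th block consisting of the link `link i` followed by `k` pairs
`(pair i s 0, pair i s 1)`, `s = 0, …, k - 1`, after which comes the next link `link (i + 1)`.
The entries are nonnegative integers that weakly decrease along the directed graph in which the
link `link i` points to both entries of the first pair, both entries of each pair point to both
entries of the next pair, and both entries of the last pair point to `link (i + 1)`; the two entries
of the same pair are not compared. From some place on, all entries are zero. -/
@[ext] structure ElongatedDiamond (k : ℕ) where
  link : ℕ → ℕ
  pair : ℕ → Fin k → Fin 2 → ℕ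
  link_succ_le_link : ∀ i, link (i + 1) ≤ link i
  pair_le_link : ∀ i s e, pair i s e ≤ link i
  pair_le_pair : ∀ i s s', s < s' → ∀ e e', pair i s' e' ≤ pair i s e
  link_succ_le_pair : ∀ i s e, link (i + 1) ≤ pair i s e
  eventually_zero : ∃ N, ∀ i, N ≤ i → link i = 0

/-- The sum of the links (a finite sum, by `eventually_zero`). -/
noncomputable def ElongatedDiamond.linkSum {k : ℕ} (D : ElongatedDiamond k) : ℕ :=
  ∑ᶠ i, D.link i

/-- `d_k(n)`: the number of `k`-elongated plane partition diamonds whose links sum to `n`. -/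
noncomputable def elongatedDiamondCount (k n : ℕ) : ℕ :=
  Nat.card {D : ElongatedDiamond k // D.linkSum = n}

/-! The rest of this file checks that the sets counted by `elongatedDiamondCount` are finite and that
the generating function is the expected one, `f₂ ^ k / f₁ ^ (3 k + 1)`. -/

namespace ElongatedDiamond

/-- The generating function of a weight. -/
noncomputable def weightGF {α : Type} (w : α → ℕ) : PowerSeries ℤ :=
  PowerSeries.mk fun n => (Nat.card {a // w a = n} : ℤ)

/-- Pairs of given total weight. -/
def fiberProdEquiv {α β : Type} (w : α → ℕ) (v : β → ℕ) (n : ℕ) :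
    {p : α × β // w p.1 + v p.2 = n} ≃
      (Σ ij : Finset.HasAntidiagonal.antidiagonal n, {a // w a = ij.1.1} × {b // v b = ij.1.2}) where
  toFun p := ⟨⟨(w p.1.1, v p.1.2), Finset.HasAntidiagonal.mem_antidiagonal.2 p.2⟩, ⟨p.1.1, rfl⟩, ⟨p.1.2, rfl⟩⟩
  invFun q := ⟨(q.2.1.1, q.2.2.1), by
    rw [q.2.1.2, q.2.2.2]; exact Finset.HasAntidiagonal.mem_antidiagonal.1 q.1.2⟩
  left_inv p := rfl
  right_inv := by
    rintro ⟨⟨⟨i, j⟩, h⟩, ⟨a, ha⟩, ⟨b, hb⟩⟩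
    dsimp only at ha hb
    subst ha hb
    rfl

theorem finite_fiber_prod {α β : Type} (w : α → ℕ) (v : β → ℕ) (n : ℕ)
    (hw : ∀ m, Finite {a // w a = m}) (hv : ∀ m ≤ n, Finite {b // v b = m}) :
    Finite {p : α × β // w p.1 + v p.2 = n} := by
  have : ∀ ij : Finset.HasAntidiagonal.antidiagonal n, Finite ({a // w a = ij.1.1} × {b // v b = ij.1.2}) := by
    rintro ⟨⟨i, j⟩, h⟩
    have := hw i
    have := hv j (by have := Finset.HasAntidiagonal.mem_antidiagonal.1 h; simp at this; omega)
    infer_instance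
  exact Finite.of_equiv _ (fiberProdEquiv w v n).symm

theorem weightGF_prod {α β : Type} (w : α → ℕ) (v : β → ℕ)
    (hw : ∀ m, Finite {a // w a = m}) (hv : ∀ m, Finite {b // v b = m}) :
    weightGF (fun p : α × β => w p.1 + v p.2) = weightGF w * weightGF v := by
  ext n
  rw [PowerSeries.coeff_mul]
  simp only [weightGF, PowerSeries.coeff_mk]
  rw [Nat.card_congr (fiberProdEquiv w v n), Nat.card_sigma,
    ← Finset.sum_coe_sort (Finset.HasAntidiagonal.antidiagonal n)]
  push_cast [Nat.card_prod]
  rfl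

theorem finite_fiber_congr {α β : Type} {w : α → ℕ} {v : β → ℕ} (e : α ≃ β)
    (h : ∀ a, w a = v (e a)) {n : ℕ} (hv : Finite {b // v b = n}) : Finite {a // w a = n} :=
  Finite.of_equiv _ (e.subtypeEquiv (p := fun a => w a = n) (q := fun b => v b = n)
    (fun a => by rw [h])).symm

theorem weightGF_congr {α β : Type} {w : α → ℕ} {v : β → ℕ} (e : α ≃ β)
    (h : ∀ a, w a = v (e a)) : weightGF w = weightGF v := by
  ext n
  simp only [weightGF, PowerSeries.coeff_mk]
  rw [Nat.card_congr (e.subtypeEquiv (p := fun a => w a = n) (q := fun b => v b = n)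
    (fun a => by rw [h]))]

/-- A single block, shifted so that the next link is zero. -/
@[ext] structure Block (k : ℕ) where
  top : ℕ
  pair : Fin k → Fin 2 → ℕ
  le_top : ∀ s e, pair s e ≤ top
  anti : ∀ s s', s < s' → ∀ e e', pair s' e' ≤ pair s e

/-- Splitting off the first block. -/
def peel (k : ℕ) : ElongatedDiamond k ≃ Block k × ElongatedDiamond k where
  toFun D :=
    (⟨D.link 0 - D.link 1, fun s e => D.pair 0 s e - D.link 1,
      fun s e => Nat.sub_le_sub_right (D.pair_le_link 0 s e) _,
      fun s s' h e e' => Nat.sub_le_sub_right (D.pair_le_pair 0 s s' h e e') _⟩,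
     ⟨fun i => D.link (i + 1), fun i => D.pair (i + 1), fun i => D.link_succ_le_link _,
      fun i => D.pair_le_link _, fun i => D.pair_le_pair _, fun i => D.link_succ_le_pair _, by
        obtain ⟨N, hN⟩ := D.eventually_zero
        exact ⟨N, fun i hi => hN _ (by omega)⟩⟩)
  invFun p :=
    { link := fun i => Nat.casesOn i (p.1.top + p.2.link 0) p.2.link
      pair := fun i => Nat.casesOn i (fun s e => p.1.pair s e + p.2.link 0) p.2.pair
      link_succ_le_link := by
        rintro (_ | i)
        · exact Nat.le_add_left _ _
        · exact p.2.link_succ_le_link i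
      pair_le_link := by
        rintro (_ | i) s e
        · exact Nat.add_le_add_right (p.1.le_top s e) _
        · exact p.2.pair_le_link i s e
      pair_le_pair := by
        rintro (_ | i) s s' h e e'
        · exact Nat.add_le_add_right (p.1.anti s s' h e e') _
        · exact p.2.pair_le_pair i s s' h e e'
      link_succ_le_pair := by
        rintro (_ | i) s e
        · exact Nat.le_add_left _ _
        · exact p.2.link_succ_le_pair i s e
      eventually_zero := by
        obtain ⟨N, hN⟩ := p.2.eventually_zero
        refine ⟨N + 1, ?_⟩
        rintro (_ | i) hi
        · omega
        · exact hN i (by omega) }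
  left_inv D := by
    ext i
    · rcases i with _ | i
      · exact Nat.sub_add_cancel (D.link_succ_le_link 0)
      · rfl
    · rename_i s e
      rcases i with _ | i
      · exact Nat.sub_add_cancel (D.link_succ_le_pair 0 s e)
      · rfl
  right_inv := by
    rintro ⟨B, D⟩
    refine Prod.ext ?_ rfl
    ext
    · simp
    · simp

theorem linkSum_peel {k : ℕ} (D : ElongatedDiamond k) :
    D.linkSum = D.link 0 + ((peel k D).2).linkSum := by
  have hs : ∀ E : ElongatedDiamond k, E.link.support.Finite := fun E => by
    obtain ⟨N, hN⟩ := E.eventually_zero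
    refine (Set.finite_lt_nat N).subset fun i hi => ?_
    by_contra h
    exact hi (hN i (not_lt.1 h))
  unfold linkSum
  rw [← tsum_eq_finsum (L := SummationFilter.unconditional ℕ) (hs _),
    ← tsum_eq_finsum (L := SummationFilter.unconditional ℕ) (hs _)]
  exact tsum_eq_zero_add' (f := D.link)
    (summable_of_hasFiniteSupport (hs (peel k D).2))

/-- Splitting off the first pair of a block. -/
def blockEquiv (k : ℕ) : Block (k + 1) ≃ (Bool × ℕ × ℕ) × Block k where
  toFun B :=
    ((decide (B.pair 0 0 < B.pair 0 1),
      max (B.pair 0 0) (B.pair 0 1) - min (B.pair 0 0) (B.pair 0 1) -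
        (decide (B.pair 0 0 < B.pair 0 1)).toNat,
      B.top - max (B.pair 0 0) (B.pair 0 1)),
     ⟨min (B.pair 0 0) (B.pair 0 1), fun s => B.pair s.succ,
      fun s e => le_min (B.anti _ _ (Fin.succ_pos s) _ _) (B.anti _ _ (Fin.succ_pos s) _ _),
      fun s s' h => B.anti _ _ (Fin.succ_lt_succ_iff.2 h)⟩)
  invFun p :=
    { top := p.2.top + p.1.2.1 + p.1.1.toNat + p.1.2.2
      pair := Fin.cons
        (if p.1.1 then ![p.2.top, p.2.top + p.1.2.1 + 1] else ![p.2.top + p.1.2.1, p.2.top])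
        p.2.pair
      le_top := by
        obtain ⟨⟨b, x, y⟩, B⟩ := p
        intro s e
        refine Fin.cases ?_ (fun s => ?_) s
        · cases b <;> fin_cases e <;> simp <;> omega
        · have := B.le_top s e
          simp only [Fin.cons_succ]
          omega
      anti := by
        obtain ⟨⟨b, x, y⟩, B⟩ := p
        intro s s' h e e'
        induction s' using Fin.cases with
        | zero => exact absurd h (Fin.not_lt_zero _)
        | succ s' =>
          induction s using Fin.cases with
          | zero =>
            have := B.le_top s' e'
            cases b <;> fin_cases e <;> simp <;> omega
          | succ s => exact B.anti s s' (Fin.succ_lt_succ_iff.1 h) e e' }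
  left_inv B := by
    have h0 := B.le_top 0 0
    have h1 := B.le_top 0 1
    ext s e
    · by_cases h : B.pair 0 0 < B.pair 0 1 <;> simp [h] <;> omega
    · induction s using Fin.cases with
      | zero =>
        by_cases h : B.pair 0 0 < B.pair 0 1 <;> fin_cases e <;> simp [h] <;> omega
      | succ s => rfl
  right_inv := by
    rintro ⟨⟨b, x, y⟩, B⟩
    cases b
    · refine Prod.ext ?_ ?_
      · simp
      · ext <;> simp
    · refine Prod.ext ?_ ?_
      · simp; omega
      · ext <;> simp <;> omega

theorem blockEquiv_top {k : ℕ} (B : Block (k + 1)) :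
    B.top = ((blockEquiv k B).1.1.toNat + ((blockEquiv k B).1.2.1 + (blockEquiv k B).1.2.2)) +
      (blockEquiv k B).2.top := by
  have h0 := B.le_top 0 0
  have h1 := B.le_top 0 1
  by_cases h : B.pair 0 0 < B.pair 0 1 <;> simp [blockEquiv, h] <;> omega

/-- A block without pairs is its top. -/
def blockZeroEquiv : Block 0 ≃ ℕ where
  toFun B := B.top
  invFun m := ⟨m, fun s => s.elim0, fun s => s.elim0, fun s => s.elim0⟩
  left_inv B := by
    ext s
    · rfl
    · exact s.elim0
  right_inv m := rfl

theorem finite_fiber_nat {c : ℕ} (hc : 0 < c) (n : ℕ) : Finite {m : ℕ // c * m = n} :=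
  ((Set.finite_le_nat n).subset fun m (hm : c * m = n) => by
    show m ≤ n
    nlinarith).to_subtype

theorem weightGF_nat {c : ℕ} (hc : 0 < c) :
    weightGF (fun m : ℕ => c * m) * (1 - PowerSeries.X ^ c) = 1 := by
  have key : weightGF (fun m : ℕ => c * m) =
      PowerSeries.mk fun n => if c ∣ n then (1 : ℤ) else 0 := by
    ext n
    simp only [weightGF, PowerSeries.coeff_mk]
    split_ifs with h
    · obtain ⟨m, rfl⟩ := h
      have : Unique {a : ℕ // c * a = c * m} :=
        ⟨⟨⟨m, rfl⟩⟩, fun a => Subtype.ext (Nat.eq_of_mul_eq_mul_left hc a.2)⟩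
      simp only [Nat.card_unique, Nat.cast_one]
    · have : IsEmpty {a : ℕ // c * a = n} := ⟨fun a => h ⟨a.1, a.2.symm⟩⟩
      simp
  rw [key]
  ext n
  rw [mul_sub, mul_one, map_sub, PowerSeries.coeff_mul_X_pow', PowerSeries.coeff_one]
  simp only [PowerSeries.coeff_mk]
  by_cases h : c ≤ n
  · have h0 : n ≠ 0 := by omega
    simp [h, h0, Nat.dvd_sub_iff_left h (dvd_refl c)]
  · by_cases h0 : n = 0
    · simp [h0, hc.ne']
    · have : ¬ c ∣ n := fun hd => h (Nat.le_of_dvd (Nat.pos_of_ne_zero h0) hd)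
      simp [h, h0, this]

theorem weightGF_bool {c : ℕ} (hc : 0 < c) :
    weightGF (fun b : Bool => c * b.toNat) = 1 + PowerSeries.X ^ c := by
  ext n
  simp only [weightGF, PowerSeries.coeff_mk, map_add, PowerSeries.coeff_one,
    PowerSeries.coeff_X_pow]
  rw [Nat.card_eq_fintype_card, Fintype.card_subtype]
  by_cases h0 : n = 0
  · subst h0
    have : ¬ (0 = c) := by omega
    have hf : (Finset.univ.filter fun b : Bool => c * b.toNat = 0) = {false} := by
      ext b
      cases b <;> simp [hc.ne']
    rw [hf]
    simp [this]
  · by_cases h1 : n = c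
    · subst h1
      simp [Finset.filter, h0]
    · simp [Finset.filter, h0, h1, Ne.symm h0, Ne.symm h1]

theorem block_gf {c : ℕ} (hc : 0 < c) (k : ℕ) :
    (∀ n, Finite {B : Block k // c * B.top = n}) ∧
    weightGF (fun B : Block k => c * B.top) * (1 - PowerSeries.X ^ c) ^ (2 * k + 1) =
      (1 + PowerSeries.X ^ c) ^ k := by
  induction k with
  | zero =>
    refine ⟨fun n => finite_fiber_congr blockZeroEquiv (v := fun m => c * m) (fun B => rfl)
      (finite_fiber_nat hc n), ?_⟩
    rw [weightGF_congr (w := fun B : Block 0 => c * B.top) blockZeroEquiv (v := fun m => c * m) (fun B => rfl)]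
    simpa using weightGF_nat hc
  | succ k ih =>
    have hN := finite_fiber_nat hc
    have hB : ∀ n, Finite {b : Bool // c * b.toNat = n} := fun n => inferInstance
    have hNN : ∀ n, Finite {p : ℕ × ℕ // c * p.1 + c * p.2 = n} := fun n =>
      finite_fiber_prod (fun m : ℕ => c * m) (fun m : ℕ => c * m) n hN fun m _ => hN m
    have hBNN : ∀ n, Finite {p : Bool × ℕ × ℕ // c * p.1.toNat + (c * p.2.1 + c * p.2.2) = n} :=
      fun n => finite_fiber_prod (fun b : Bool => c * b.toNat)
        (fun p : ℕ × ℕ => c * p.1 + c * p.2) n hB fun m _ => hNN m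
    have hw : ∀ B : Block (k + 1), c * B.top =
        (fun p : (Bool × ℕ × ℕ) × Block k =>
          (c * p.1.1.toNat + (c * p.1.2.1 + c * p.1.2.2)) + c * p.2.top) (blockEquiv k B) := by
      intro B
      show c * B.top = (_ + (_ + _)) + _
      rw [blockEquiv_top B]
      ring
    refine ⟨fun n => finite_fiber_congr (w := fun B : Block (k + 1) => c * B.top)
      (v := fun p : (Bool × ℕ × ℕ) × Block k =>
        (c * p.1.1.toNat + (c * p.1.2.1 + c * p.1.2.2)) + c * p.2.top) (blockEquiv k) hw
      (finite_fiber_prod (fun p : Bool × ℕ × ℕ => c * p.1.toNat + (c * p.2.1 + c * p.2.2))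
        (fun B : Block k => c * B.top) n hBNN fun m _ => ih.1 m), ?_⟩
    rw [weightGF_congr (w := fun B : Block (k + 1) => c * B.top)
        (v := fun p : (Bool × ℕ × ℕ) × Block k =>
          (c * p.1.1.toNat + (c * p.1.2.1 + c * p.1.2.2)) + c * p.2.top) (blockEquiv k) hw,
      weightGF_prod (fun p : Bool × ℕ × ℕ => c * p.1.toNat + (c * p.2.1 + c * p.2.2))
        (fun B : Block k => c * B.top) hBNN ih.1,
      weightGF_prod (fun b : Bool => c * b.toNat) (fun p : ℕ × ℕ => c * p.1 + c * p.2) hB hNN,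
      weightGF_prod (fun m : ℕ => c * m) (fun m : ℕ => c * m) hN hN, weightGF_bool hc]
    have h1 := weightGF_nat hc
    have h2 := ih.2
    generalize weightGF (fun m : ℕ => c * m) = G at *
    generalize weightGF (fun B : Block k => c * B.top) = H at *
    generalize (PowerSeries.X ^ c : PowerSeries ℤ) = y at *
    calc (1 + y) * (G * G) * H * (1 - y) ^ (2 * (k + 1) + 1)
        = (1 + y) * (G * (1 - y)) ^ 2 * (H * (1 - y) ^ (2 * k + 1)) := by ring
      _ = _ := by rw [h1, h2]; ring

theorem eq_of_link_zero {k : ℕ} (D E : ElongatedDiamond k) (hD : D.link 0 = 0)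
    (hE : E.link 0 = 0) : D = E := by
  have h : ∀ F : ElongatedDiamond k, F.link 0 = 0 → ∀ i, F.link i = 0 := by
    intro F hF i
    induction i with
    | zero => exact hF
    | succ i ih => exact Nat.le_zero.1 (ih ▸ F.link_succ_le_link i)
  ext i s e
  · rw [h D hD, h E hE]
  · have h1 := D.pair_le_link i s e
    have h2 := E.pair_le_link i s e
    rw [h D hD] at h1
    rw [h E hE] at h2
    omega

/-- The diamond all of whose entries are zero. -/
def zeroDiamond (k : ℕ) : ElongatedDiamond k :=
  ⟨fun _ => 0, fun _ _ _ => 0, by simp, by simp, by simp, by simp, ⟨0, by simp⟩⟩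

/-- The auxiliary weight that counts the first link `t` more times. -/
noncomputable def shiftedSum (k t : ℕ) (D : ElongatedDiamond k) : ℕ := D.linkSum + t * D.link 0

theorem shiftedSum_peel (k t : ℕ) (D : ElongatedDiamond k) :
    shiftedSum k t D =
      (t + 1) * (peel k D).1.top + shiftedSum k (t + 1) (peel k D).2 := by
  have h : D.link 0 = (peel k D).1.top + (peel k D).2.link 0 :=
    (Nat.sub_add_cancel (D.link_succ_le_link 0)).symm
  rw [shiftedSum, shiftedSum, linkSum_peel, h]
  ring

theorem link_zero_of_shiftedSum_lt {k t : ℕ} {D : ElongatedDiamond k}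
    (h : shiftedSum k t D < t + 1) : D.link 0 = 0 := by
  rw [shiftedSum, linkSum_peel] at h
  by_contra h0
  have : 1 ≤ D.link 0 := Nat.one_le_iff_ne_zero.2 h0
  nlinarith

theorem finite_shiftedSum (k t n : ℕ) : Finite {D : ElongatedDiamond k // shiftedSum k t D = n} := by
  have key : ∀ d t, n ≤ t + d → ∀ m ≤ n, Finite {D : ElongatedDiamond k // shiftedSum k t D = m} := by
    intro d
    induction d with
    | zero =>
      intro t ht m hm
      have : Subsingleton {D : ElongatedDiamond k // shiftedSum k t D = m} :=
        ⟨fun D E => Subtype.ext (eq_of_link_zero _ _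
          (link_zero_of_shiftedSum_lt (by rw [D.2]; omega))
          (link_zero_of_shiftedSum_lt (by rw [E.2]; omega)))⟩
      infer_instance
    | succ d ih =>
      intro t ht m hm
      exact finite_fiber_congr (peel k)
        (v := fun p => (t + 1) * p.1.top + shiftedSum k (t + 1) p.2) (shiftedSum_peel k t)
        (finite_fiber_prod (fun B : Block k => (t + 1) * B.top) (shiftedSum k (t + 1)) m
          (block_gf (Nat.succ_pos t) k).1
          fun m' hm' => ih (t + 1) (by omega) m' (hm'.trans hm))
  exact key n t (by omega) n le_rfl

theorem weightGF_shiftedSum_mul (k t : ℕ) :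
    weightGF (shiftedSum k t) * (1 - PowerSeries.X ^ (t + 1)) ^ (3 * k + 1) =
      (1 - PowerSeries.X ^ (2 * (t + 1))) ^ k * weightGF (shiftedSum k (t + 1)) := by
  rw [weightGF_congr (peel k)
      (v := fun p => (t + 1) * p.1.top + shiftedSum k (t + 1) p.2) (shiftedSum_peel k t),
    weightGF_prod (fun B : Block k => (t + 1) * B.top) (shiftedSum k (t + 1))
      (block_gf (Nat.succ_pos t) k).1 (finite_shiftedSum k (t + 1))]
  have h := (block_gf (Nat.succ_pos t) k).2
  rw [mul_comm 2 (t + 1), pow_mul]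
  generalize weightGF (fun B : Block k => (t + 1) * B.top) = H at *
  generalize weightGF (shiftedSum k (t + 1)) = G at *
  simp only [Nat.succ_eq_add_one] at h
  generalize (PowerSeries.X ^ (t + 1) : PowerSeries ℤ) = y at *
  calc H * G * (1 - y) ^ (3 * k + 1)
      = (H * (1 - y) ^ (2 * k + 1)) * (1 - y) ^ k * G := by ring
    _ = ((1 + y) * (1 - y)) ^ k * G := by rw [h, mul_pow]
    _ = _ := by ring

theorem weightGF_shiftedSum_prod (k L : ℕ) :
    weightGF (shiftedSum k 0) *
        (∏ i ∈ Finset.range L, (1 - PowerSeries.X ^ (i + 1))) ^ (3 * k + 1) =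
      (∏ i ∈ Finset.range L, (1 - PowerSeries.X ^ (2 * (i + 1)))) ^ k *
        weightGF (shiftedSum k L) := by
  induction L with
  | zero => simp
  | succ L ih =>
    rw [Finset.prod_range_succ, Finset.prod_range_succ, mul_pow, mul_pow, ← mul_assoc, ih,
      mul_assoc, mul_assoc, weightGF_shiftedSum_mul]

theorem coeff_weightGF_shiftedSum {k L n : ℕ} (h : n < L) :
    PowerSeries.coeff n (weightGF (shiftedSum k L)) = if n = 0 then 1 else 0 := by
  have hz : shiftedSum k L (zeroDiamond k) = 0 := by
    simp [shiftedSum, linkSum, zeroDiamond]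
  simp only [weightGF, PowerSeries.coeff_mk]
  have hD : ∀ D : ElongatedDiamond k, shiftedSum k L D = n → D = zeroDiamond k := fun D hD =>
    eq_of_link_zero _ _ (link_zero_of_shiftedSum_lt (t := L) (by rw [hD]; omega)) rfl
  split_ifs with h0
  · subst h0
    have : Unique {D : ElongatedDiamond k // shiftedSum k L D = 0} :=
      ⟨⟨⟨zeroDiamond k, hz⟩⟩, fun D => Subtype.ext (hD D.1 D.2)⟩
    simp
  · have : IsEmpty {D : ElongatedDiamond k // shiftedSum k L D = n} :=
      ⟨fun D => h0 (by rw [← D.2, hD D.1 D.2, hz])⟩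
    simp

end ElongatedDiamond

open scoped PowerSeries.WithPiTopology in
/-- With `f_r = ∏ (1 - q ^ (r m))`, `m ≥ 1`, as formal power series over the (discrete) integers:
`(∑ d_k(n) q ^ n) f_1 ^ (3 k + 1) = f_2 ^ k`. -/
theorem elongatedDiamondCount_generatingFunction (k : ℕ) :
    PowerSeries.mk (fun n => (elongatedDiamondCount k n : ℤ)) *
        (∏' m : ℕ, (1 - PowerSeries.X ^ (m + 1) : PowerSeries ℤ)) ^ (3 * k + 1) =
      (∏' m : ℕ, (1 - PowerSeries.X ^ (2 * (m + 1)) : PowerSeries ℤ)) ^ k := by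
  have h0 : PowerSeries.mk (fun n => (elongatedDiamondCount k n : ℤ)) =
      ElongatedDiamond.weightGF (ElongatedDiamond.shiftedSum k 0) := by
    have : ElongatedDiamond.shiftedSum k 0 = ElongatedDiamond.linkSum := by
      funext D
      simp [ElongatedDiamond.shiftedSum]
    rw [this]
    rfl
  have m1 : Multipliable fun m : ℕ => (1 - PowerSeries.X ^ (m + 1) : PowerSeries ℤ) :=
    PowerSeries.WithPiTopology.multipliable_one_sub_X_pow ℤ
  have m2 : Multipliable fun m : ℕ => (1 - PowerSeries.X ^ (2 * (m + 1)) : PowerSeries ℤ) := by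
    simp_rw [sub_eq_add_neg]
    apply PowerSeries.WithPiTopology.multipliable_one_add_of_tendsto_order_atTop_nhds_top
    refine ENat.tendsto_nhds_top_iff_natCast_lt.mpr fun n => Filter.eventually_atTop.mpr ⟨n, ?_⟩
    intro m hm
    rw [PowerSeries.order_neg, PowerSeries.order_X_pow]
    norm_cast
    omega
  have t3 : Filter.Tendsto (fun L => ElongatedDiamond.weightGF (ElongatedDiamond.shiftedSum k L))
      Filter.atTop (nhds 1) := by
    rw [PowerSeries.WithPiTopology.tendsto_iff_coeff_tendsto]
    intro n
    refine tendsto_const_nhds.congr' ?_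
    filter_upwards [Filter.eventually_gt_atTop n] with L hL
    rw [ElongatedDiamond.coeff_weightGF_shiftedSum hL, PowerSeries.coeff_one]
  rw [h0]
  refine tendsto_nhds_unique ((m1.hasProd.tendsto_prod_nat.pow (3 * k + 1)).const_mul _) ?_
  simp_rw [ElongatedDiamond.weightGF_shiftedSum_prod]
  simpa using (m2.hasProd.tendsto_prod_nat.pow k).mul t3

/-!
Write `f_r = ∏ (1 - q ^ (r m))`. The generating function of the numbers `d_k(n)` is
`f₂ ^ k / f₁ ^ (3 k + 1)`. Modulo a prime `p`, a `p`-th power is a series in `q ^ p`, so multiplying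
by it or by its inverse does not mix the residue classes of exponents modulo `p`
(`residuePart_eq_zero_of_mul_pow`). Hence only `k` modulo `p` matters, and after removing `p`-th
powers the generating function becomes, in almost every case, a theta series with known exponents:

* `k ≡ -1`: `f₁² / f₂ = ∑ (-1) ^ j q ^ (j²)`, so that non-squares do not occur as exponents;
* `k ≡ -2`: `f₁⁵ / f₂² = ∑ (6 m + 1) q ^ (m (3 m + 1) / 2)`, and for `p = 7`, `k ≡ 5`:
  `f₂⁵ / f₁² = ∑ (-1) ^ m (3 m + 1) q ^ (m (3 m + 2))`; an exponent either avoids the given residue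
  class or has a weight divisible by `p`;
* `p = 2`, `k ≡ 1`: `f₂`; `p = 3`, `k ≡ 2`: `f₂² / f₁ = ∑ q ^ (j (j + 1) / 2)`; `p = 5`, `k ≡ 3`:
  Jacobi's series for `f₂³`;
* `k ≡ 0`: the partition generating function `1 / f₁`, that is `f₁ f₁³` for `p = 5`, `(f₁³)²` for
  `p = 7` and `(f₁³)⁷` for `p = 11`; the last case follows from relations between the parts of `f₁³`
  in the residue classes modulo `11` (`residuePart_cube_pow_seven`);
* `p = 11`, `k ≡ 2`: `f₁⁴ f₂²`, which is a combination of two binary theta series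
  (`eulerProd_four_two`).

The formulas of Gauss and Jacobi come from a finite form of the triple product, `finiteTheta_eq`, in
which `z ^ j` is replaced by any solution of `w (j + 1) + w (j - 1) = t w j`: this includes the
weight `(-1) ^ j (2 j + 1)` of Jacobi's series, where `t = -2`. The two formulas with linear weights
and the one for `f₁⁴ f₂²` follow by rewriting products of two theta series as sums over `ℤ²` and
splitting the lattice into translates of a sublattice.
-/

section DiamondCongruences

open PowerSeries

/-! ### Theta series -/

section ThetaSeries

variable {ι κ R S : Type*} [CommRing R] [CommRing S]

/-- The series `∑ᵢ wᵢ X ^ eᵢ`; it is meaningful when every exponent occurs only finitely often. -/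
noncomputable def thetaSeries (e : ι → ℕ) (w : ι → R) : R⟦X⟧ :=
  PowerSeries.mk fun n => ∑ᶠ i, if e i = n then w i else 0

/-- Only finitely many indices have a bounded exponent. -/
def FiniteFibers (e : ι → ℕ) : Prop := ∀ n, {i | e i ≤ n}.Finite

theorem coeff_thetaSeries_eq_sum {e : ι → ℕ} (w : ι → R) {n : ℕ} {s : Finset ι}
    (hs : ∀ i, e i = n → i ∈ s) :
    coeff n (thetaSeries e w) = ∑ i ∈ s, if e i = n then w i else 0 := by
  rw [thetaSeries, coeff_mk]
  refine finsum_eq_sum_of_support_subset _ fun i hi => ?_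
  refine hs i ?_
  by_contra h
  exact hi (if_neg h)

theorem coeff_thetaSeries_eq_zero {e : ι → ℕ} {w : ι → R} {n : ℕ}
    (h : ∀ i, e i = n → w i = 0) : coeff n (thetaSeries e w) = 0 := by
  rw [thetaSeries, coeff_mk]
  refine finsum_eq_zero_of_forall_eq_zero fun i => ?_
  split_ifs with hi
  exacts [h i hi, rfl]

theorem thetaSeries_congr (f : ι ≃ κ) {e : ι → ℕ} {w : ι → R} {e' : κ → ℕ} {w' : κ → R}
    (he : ∀ i, e' (f i) = e i) (hw : ∀ i, w' (f i) = w i) :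
    thetaSeries e w = thetaSeries e' w' := by
  ext n
  rw [thetaSeries, thetaSeries, coeff_mk, coeff_mk]
  refine finsum_eq_of_bijective f f.bijective fun i => ?_
  rw [he, hw]

theorem FiniteFibers.of_equiv (f : ι ≃ κ) {e : ι → ℕ} {e' : κ → ℕ} (he : ∀ i, e' (f i) = e i)
    (h : FiniteFibers e') : FiniteFibers e := fun n => by
  refine ((h n).preimage f.injective.injOn).subset fun i hi => ?_
  simpa [he] using hi

theorem FiniteFibers.finite_support {e : ι → ℕ} (h : FiniteFibers e) (w : ι → R) (n : ℕ) :
    (Function.support fun i => if e i = n then w i else 0).Finite :=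
  (h n).subset fun i hi => by
    by_contra hn
    exact hi (if_neg fun hh => hn hh.le)

theorem thetaSeries_add {e : ι → ℕ} (h : FiniteFibers e) (v w : ι → R) :
    thetaSeries e (fun i => v i + w i) = thetaSeries e v + thetaSeries e w := by
  ext n
  rw [map_add]
  simp only [thetaSeries, coeff_mk]
  rw [← finsum_add_distrib (h.finite_support v n) (h.finite_support w n)]
  refine finsum_congr fun i => ?_
  split_ifs <;> simp

theorem map_thetaSeries (f : R →+* S) {e : ι → ℕ} (h : FiniteFibers e) (w : ι → R) :
    map f (thetaSeries e w) = thetaSeries e fun i => f (w i) := by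
  ext n
  simp only [coeff_map, thetaSeries, coeff_mk]
  refine (f.toAddMonoidHom.map_finsum (h.finite_support w n)).trans (finsum_congr fun i => ?_)
  split_ifs <;> simp

theorem thetaSeries_const_mul {e : ι → ℕ} (h : FiniteFibers e) (c : R) (w : ι → R) :
    thetaSeries e (fun i => c * w i) = C c * thetaSeries e w := by
  ext n
  rw [coeff_C_mul, coeff_thetaSeries_eq_sum (s := (h n).toFinset) _ fun i hi => by simp [hi],
    coeff_thetaSeries_eq_sum (s := (h n).toFinset) _ fun i hi => by simp [hi], Finset.mul_sum]
  exact Finset.sum_congr rfl fun i _ => by split_ifs <;> simp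

theorem thetaSeries_neg (e : ι → ℕ) (w : ι → R) :
    thetaSeries e (fun i => -w i) = -thetaSeries e w := by
  ext n
  rw [map_neg]
  simp only [thetaSeries, coeff_mk]
  rw [← finsum_neg_distrib]
  refine finsum_congr fun i => ?_
  split_ifs <;> simp

theorem FiniteFibers.prod {e : ι → ℕ} {d : κ → ℕ} (he : FiniteFibers e) (hd : FiniteFibers d) :
    FiniteFibers fun p : ι × κ => e p.1 + d p.2 := fun n => by
  refine ((he n).prod (hd n)).subset fun p hp => ?_
  simp only [Set.mem_ofPred_eq] at hp
  exact ⟨by simp; omega, by simp; omega⟩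

theorem coeff_thetaSeries_eq_coeff_sum {e : ι → ℕ} (h : FiniteFibers e) (w : ι → R) {k n : ℕ}
    (hk : k ≤ n) : coeff k (thetaSeries e w) =
      coeff k (∑ i ∈ (h n).toFinset, monomial (e i) (w i)) := by
  rw [coeff_thetaSeries_eq_sum (s := (h n).toFinset) w fun i hi => by simp; omega, map_sum]
  refine Finset.sum_congr rfl fun i _ => ?_
  rw [coeff_monomial]
  simp only [eq_comm]

theorem thetaSeries_mul {e : ι → ℕ} {d : κ → ℕ} (he : FiniteFibers e) (hd : FiniteFibers d)
    (v : ι → R) (w : κ → R) :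
    thetaSeries e v * thetaSeries d w =
      thetaSeries (fun p : ι × κ => e p.1 + d p.2) fun p => v p.1 * w p.2 := by
  ext n
  have h : coeff n (thetaSeries e v * thetaSeries d w) =
      coeff n ((∑ i ∈ (he n).toFinset, monomial (e i) (v i)) *
        ∑ i ∈ (hd n).toFinset, monomial (d i) (w i)) := by
    rw [coeff_mul, coeff_mul]
    refine Finset.sum_congr rfl fun p hp => ?_
    have := Finset.HasAntidiagonal.mem_antidiagonal.1 hp
    rw [coeff_thetaSeries_eq_coeff_sum he v (by omega : p.1 ≤ n),
      coeff_thetaSeries_eq_coeff_sum hd w (by omega : p.2 ≤ n)]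
  rw [h, Finset.sum_mul_sum, ← Finset.sum_product', map_sum,
    coeff_thetaSeries_eq_sum (s := (he n).toFinset ×ˢ (hd n).toFinset)]
  · refine Finset.sum_congr rfl fun p _ => ?_
    rw [monomial_mul_monomial, coeff_monomial]
    simp only [eq_comm]
  · intro p hp
    simp
    omega

/-- A sum over a disjoint union of three index sets. -/
theorem thetaSeries_prod_fin_three {e : ι × Fin 3 → ℕ} (h : FiniteFibers e) (w : ι × Fin 3 → R) :
    thetaSeries e w = thetaSeries (fun i => e (i, 0)) (fun i => w (i, 0)) +
      thetaSeries (fun i => e (i, 1)) (fun i => w (i, 1)) +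
      thetaSeries (fun i => e (i, 2)) (fun i => w (i, 2)) := by
  classical
  ext n
  set s := ((h n).toFinset).image Prod.fst
  have hs : ∀ i c, e (i, c) = n → i ∈ s := fun i c hi =>
    Finset.mem_image.2 ⟨(i, c), by simp [hi], rfl⟩
  rw [map_add, map_add, coeff_thetaSeries_eq_sum w (s := s ×ˢ Finset.univ)
      fun p hp => Finset.mem_product.2 ⟨hs p.1 p.2 hp, Finset.mem_univ _⟩,
    coeff_thetaSeries_eq_sum (s := s) _ fun i hi => hs i 0 hi,
    coeff_thetaSeries_eq_sum (s := s) _ fun i hi => hs i 1 hi,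
    coeff_thetaSeries_eq_sum (s := s) _ fun i hi => hs i 2 hi, Finset.sum_product,
    ← Finset.sum_add_distrib, ← Finset.sum_add_distrib]
  exact Finset.sum_congr rfl fun i _ => by rw [Fin.sum_univ_three]

/-- A sum over a disjoint union of two index sets. -/
theorem thetaSeries_prod_fin_two {e : ι × Fin 2 → ℕ} (h : FiniteFibers e) (w : ι × Fin 2 → R) :
    thetaSeries e w = thetaSeries (fun i => e (i, 0)) (fun i => w (i, 0)) +
      thetaSeries (fun i => e (i, 1)) (fun i => w (i, 1)) := by
  classical
  ext n
  set s := ((h n).toFinset).image Prod.fst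
  have hs : ∀ i c, e (i, c) = n → i ∈ s := fun i c hi =>
    Finset.mem_image.2 ⟨(i, c), by simp [hi], rfl⟩
  rw [map_add, coeff_thetaSeries_eq_sum w (s := s ×ˢ Finset.univ)
      fun p hp => Finset.mem_product.2 ⟨hs p.1 p.2 hp, Finset.mem_univ _⟩,
    coeff_thetaSeries_eq_sum (s := s) _ fun i hi => hs i 0 hi,
    coeff_thetaSeries_eq_sum (s := s) _ fun i hi => hs i 1 hi, Finset.sum_product,
    ← Finset.sum_add_distrib]
  exact Finset.sum_congr rfl fun i _ => by rw [Fin.sum_univ_two]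

theorem expand_thetaSeries {r : ℕ} (hr : r ≠ 0) (e : ι → ℕ) (w : ι → R) :
    expand r hr (thetaSeries e w) = thetaSeries (fun i => r * e i) w := by
  ext n
  rw [coeff_expand]
  split_ifs with h
  · obtain ⟨m, rfl⟩ := h
    rw [Nat.mul_div_cancel_left _ (Nat.pos_of_ne_zero hr)]
    simp [thetaSeries, hr]
  · rw [coeff_thetaSeries_eq_zero fun i hi => absurd ⟨e i, hi.symm⟩ h]

theorem rescale_thetaSeries (c : R) {e : ι → ℕ} (h : FiniteFibers e) (w : ι → R) :
    rescale c (thetaSeries e w) = thetaSeries e fun i => c ^ e i * w i := by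
  ext n
  rw [coeff_rescale, coeff_thetaSeries_eq_sum (s := (h n).toFinset) _ fun i hi => by simp [hi],
    coeff_thetaSeries_eq_sum (s := (h n).toFinset) _ fun i hi => by simp [hi], Finset.mul_sum]
  refine Finset.sum_congr rfl fun i _ => ?_
  split_ifs with hi
  · rw [hi]
  · simp

theorem X_pow_mul_thetaSeries (a : ℕ) (e : ι → ℕ) (w : ι → R) :
    X ^ a * thetaSeries e w = thetaSeries (fun i => a + e i) w := by
  ext n
  rw [coeff_X_pow_mul']
  split_ifs with h
  · simp only [thetaSeries, coeff_mk]
    refine finsum_congr fun i => ?_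
    have : e i = n - a ↔ a + e i = n := by omega
    simp only [this]
  · rw [coeff_thetaSeries_eq_zero fun i hi => by omega]

/-- An involution of the index set that preserves exponents and reverses weights. -/
theorem thetaSeries_eq_zero_of_antisymm {e : ι → ℕ} {w : ι → ℤ} (f : ι ≃ ι)
    (he : ∀ i, e (f i) = e i) (hw : ∀ i, w (f i) = -w i) : thetaSeries e w = 0 := by
  have h := (thetaSeries_congr (e := e) (w := fun i => -w i) f he hw).symm
  rw [thetaSeries_neg] at h
  ext n
  have := congrArg (coeff n) h
  rw [map_neg] at this
  rw [map_zero]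
  omega

end ThetaSeries

/-! ### Euler products -/

section EulerProducts

open Filter Topology
open scoped PowerSeries.WithPiTopology

/-- The finite product `(q ^ r; q ^ r)_n`. -/
noncomputable def eulerPartial (r n : ℕ) : ℤ⟦X⟧ := ∏ i ∈ Finset.range n, (1 - X ^ (r * (i + 1)))

/-- The infinite product `f_r = (q ^ r; q ^ r)_∞`. -/
noncomputable def eulerProd (r : ℕ) : ℤ⟦X⟧ := ∏' i : ℕ, (1 - X ^ (r * (i + 1)))

theorem eulerPartial_succ (r n : ℕ) :
    eulerPartial r (n + 1) = eulerPartial r n * (1 - X ^ (r * (n + 1))) :=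
  Finset.prod_range_succ _ _

theorem tendsto_eulerPartial {r : ℕ} (hr : 0 < r) :
    Tendsto (eulerPartial r) atTop (𝓝 (eulerProd r)) := by
  have m2 : Multipliable fun m : ℕ => (1 - X ^ (r * (m + 1)) : ℤ⟦X⟧) := by
    simp_rw [sub_eq_add_neg]
    apply PowerSeries.WithPiTopology.multipliable_one_add_of_tendsto_order_atTop_nhds_top
    refine ENat.tendsto_nhds_top_iff_natCast_lt.mpr fun n => eventually_atTop.mpr ⟨n, ?_⟩
    intro m hm
    rw [order_neg, order_X_pow]
    norm_cast
    nlinarith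
  exact m2.hasProd.tendsto_prod_nat

theorem constantCoeff_eulerPartial {r : ℕ} (hr : 0 < r) (n : ℕ) :
    constantCoeff (eulerPartial r n) = 1 := by
  rw [eulerPartial, map_prod]
  refine Finset.prod_eq_one fun i _ => ?_
  have : r * (i + 1) ≠ 0 := by positivity
  simp [this]

theorem constantCoeff_eulerProd {r : ℕ} (hr : 0 < r) : constantCoeff (eulerProd r) = 1 := by
  have h := ((WithPiTopology.continuous_constantCoeff ℤ).tendsto _).comp (tendsto_eulerPartial hr)
  exact tendsto_nhds_unique h (tendsto_const_nhds.congr fun n =>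
    (constantCoeff_eulerPartial hr n).symm)

theorem eulerProd_ne_zero {r : ℕ} (hr : 0 < r) : eulerProd r ≠ 0 := fun h => by
  have := constantCoeff_eulerProd hr
  simp [h] at this

theorem tendsto_expand {k : ℕ} (hk : k ≠ 0) {u : ℕ → ℤ⟦X⟧} {a : ℤ⟦X⟧}
    (h : Tendsto u atTop (𝓝 a)) :
    Tendsto (fun n => expand k hk (u n)) atTop (𝓝 (expand k hk a)) := by
  rw [WithPiTopology.tendsto_iff_coeff_tendsto] at h ⊢
  intro d
  simp only [coeff_expand]
  split_ifs
  exacts [h _, tendsto_const_nhds]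

theorem expand_eulerProd {k : ℕ} (hk : k ≠ 0) {r : ℕ} (hr : 0 < r) :
    expand k hk (eulerProd r) = eulerProd (k * r) := by
  refine tendsto_nhds_unique (tendsto_expand hk (tendsto_eulerPartial hr))
    ((tendsto_eulerPartial (Nat.mul_pos (Nat.pos_of_ne_zero hk) hr)).congr fun n => ?_)
  rw [eulerPartial, eulerPartial, map_prod]
  refine Finset.prod_congr rfl fun i _ => ?_
  rw [map_sub, map_one, map_pow, expand_X, ← pow_mul, mul_assoc]

theorem expand_injective {R : Type*} [CommRing R] {k : ℕ} (hk : k ≠ 0) :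
    Function.Injective (expand k hk : R⟦X⟧ → R⟦X⟧) := fun a b h => by
  ext n
  rw [← coeff_expand_mul k hk, h, coeff_expand_mul]

/-- The inverse of `(q²; q²)_n`. -/
noncomputable def invPartial (n : ℕ) : ℤ⟦X⟧ := invOfUnit (eulerPartial 2 n) 1

theorem eulerPartial_mul_invPartial (n : ℕ) : eulerPartial 2 n * invPartial n = 1 :=
  mul_invOfUnit _ _ (by simpa using constantCoeff_eulerPartial two_pos n)

theorem invPartial_succ (n : ℕ) :
    invPartial n = (1 - X ^ (2 * (n + 1))) * invPartial (n + 1) := by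
  have h1 := eulerPartial_mul_invPartial n
  have h2 := eulerPartial_mul_invPartial (n + 1)
  rw [eulerPartial_succ] at h2
  linear_combination (-invPartial n) * h2 + (1 - X ^ (2 * (n + 1))) * invPartial (n + 1) * h1

/-- The inverses of the partial products converge, because the coefficient of `q ^ k` is
constant from index `k` on. -/
theorem exists_tendsto_invPartial :
    ∃ G : ℤ⟦X⟧, Tendsto invPartial atTop (𝓝 G) ∧ eulerProd 2 * G = 1 := by
  have hc : ∀ k m, coeff k (invPartial (k + m)) = coeff k (invPartial k) := by
    intro k m
    induction m with
    | zero => rfl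
    | succ m ih =>
      rw [← ih, invPartial_succ (k + m), sub_mul, one_mul, map_sub, coeff_X_pow_mul',
        if_neg (by omega), sub_zero]
      rfl
  have hG : Tendsto invPartial atTop (𝓝 (PowerSeries.mk fun k => coeff k (invPartial k))) := by
    rw [WithPiTopology.tendsto_iff_coeff_tendsto]
    intro k
    refine tendsto_const_nhds.congr' ?_
    filter_upwards [eventually_ge_atTop k] with n hn
    obtain ⟨m, rfl⟩ := Nat.exists_eq_add_of_le hn
    rw [hc, coeff_mk]
  refine ⟨_, hG, tendsto_nhds_unique ((tendsto_eulerPartial two_pos).mul hG) ?_⟩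
  exact tendsto_const_nhds.congr fun n => (eulerPartial_mul_invPartial n).symm

end EulerProducts

/-! ### A finite form of the Jacobi triple product -/

section TripleProduct

open Filter Topology
open scoped PowerSeries.WithPiTopology

/-- The inverse of `(q²; q²)_a`, extended by zero to negative `a`. -/
noncomputable def invPoch (a : ℤ) : ℤ⟦X⟧ := if a < 0 then 0 else invPartial a.toNat

theorem invPoch_of_neg {a : ℤ} (h : a < 0) : invPoch a = 0 := if_pos h

theorem invPoch_natCast (a : ℕ) : invPoch a = invPartial a := by
  simp [invPoch]

theorem invPoch_sub_one (a : ℕ) : invPoch (a - 1) = (1 - X ^ (2 * a)) * invPoch a := by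
  cases a with
  | zero => simp [invPoch]
  | succ a =>
    rw [invPoch_natCast, ← invPartial_succ, ← invPoch_natCast]
    push_cast
    ring_nf

theorem sq_mul_invPoch_sub_two (a : ℕ) :
    X ^ 2 * invPoch (a - 2) = (1 - X ^ (2 * a)) * (X ^ 2 - X ^ (2 * a)) * invPoch a := by
  cases a with
  | zero => simp [invPoch]
  | succ a =>
    have h := invPoch_sub_one a
    have h2 := invPoch_sub_one (a + 1)
    push_cast at h2 ⊢
    rw [add_sub_cancel_right] at h2
    rw [show (a : ℤ) + 1 - 2 = a - 1 by ring, h, h2]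
    ring

/-- The recurrence of the centred `q`-binomial coefficients, with base `q²`, under raising the upper
index by two. -/
theorem invPoch_recurrence (a b c : ℕ) (h : a + b = c + 1) :
    (1 - X ^ (2 * c)) * (1 - X ^ (2 * (c + 1))) * (invPoch a * invPoch b) =
      (1 + X ^ (2 * c)) * (invPoch (a - 1) * invPoch (b - 1)) +
        X ^ (2 * a) * (invPoch a * invPoch (b - 2)) +
        X ^ (2 * b) * (invPoch (a - 2) * invPoch b) := by
  have hX : (X ^ 2 : ℤ⟦X⟧) ≠ 0 := pow_ne_zero _ X_ne_zero
  refine mul_left_cancel₀ hX ?_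
  have h1 : (X : ℤ⟦X⟧) ^ 2 * X ^ (2 * c) = X ^ (2 * a) * X ^ (2 * b) := by
    rw [← pow_add, ← pow_add]
    congr 1
    omega
  have h2 : (X : ℤ⟦X⟧) ^ (2 * (c + 1)) = X ^ (2 * a) * X ^ (2 * b) := by
    rw [← pow_add]
    congr 1
    omega
  have ha := sq_mul_invPoch_sub_two a
  have hb := sq_mul_invPoch_sub_two b
  rw [h2, invPoch_sub_one a, invPoch_sub_one b]
  generalize invPoch (a - 2) = ga at *
  generalize invPoch (b - 2) = gb at *
  generalize invPoch (a : ℤ) = A at *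
  generalize invPoch (b : ℤ) = B at *
  generalize (X : ℤ⟦X⟧) ^ (2 * a) = x at *
  generalize (X : ℤ⟦X⟧) ^ (2 * b) = y at *
  generalize (X : ℤ⟦X⟧) ^ (2 * c) = z at *
  linear_combination (-(1 - x * y) * A * B - (1 - x) * (1 - y) * A * B) * h1 -
    x * A * hb - y * B * ha

/-- The `j`-th term, without its weight, of the finite theta sum. -/
noncomputable def finiteTerm (s n : ℕ) (j : ℤ) : ℤ⟦X⟧ :=
  X ^ (j ^ 2 + s * j).toNat * (invPoch (n - j) * invPoch (n + s + j))

theorem finiteTerm_eq_zero {s n : ℕ} {j : ℤ} (h : j ∉ Finset.Icc (-(n + s) : ℤ) n) :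
    finiteTerm s n j = 0 := by
  rw [Finset.mem_Icc, not_and_or] at h
  rcases h with h | h
  · rw [finiteTerm, invPoch_of_neg (a := n + s + j) (by omega), mul_zero, mul_zero]
  · rw [finiteTerm, invPoch_of_neg (a := n - j) (by omega), zero_mul, mul_zero]

theorem sq_add_mul_nonneg {s : ℕ} (hs : s ≤ 1) (j : ℤ) : 0 ≤ j ^ 2 + s * j := by
  have : (s : ℤ) = 0 ∨ (s : ℤ) = 1 := by omega
  rcases this with h | h <;> rw [h]
  · nlinarith [sq_nonneg j]
  · rcases le_or_gt 0 j with h0 | h0 <;> nlinarith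

theorem finiteTerm_recurrence {s : ℕ} (hs : s ≤ 1) (n : ℕ) (j : ℤ) :
    (1 - X ^ (2 * (2 * n + 1 + s))) * (1 - X ^ (2 * (2 * n + 2 + s))) * finiteTerm s (n + 1) j =
      (1 + X ^ (2 * (2 * n + 1 + s))) * finiteTerm s n j +
        X ^ (2 * n + 1 + s) * finiteTerm s n (j - 1) +
        X ^ (2 * n + 1 + s) * finiteTerm s n (j + 1) := by
  by_cases hj : j ∈ Finset.Icc (-((n + 1 : ℕ) + s) : ℤ) (n + 1 : ℕ)
  · rw [Finset.mem_Icc] at hj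
    push_cast at hj
    obtain ⟨a, ha⟩ := Int.eq_ofNat_of_zero_le (a := n + 1 - j) (by omega)
    obtain ⟨b, hb⟩ := Int.eq_ofNat_of_zero_le (a := n + 1 + s + j) (by omega)
    have hrec := invPoch_recurrence a b (2 * n + 1 + s) (by omega)
    have e0 := sq_add_mul_nonneg hs j
    have e1 := sq_add_mul_nonneg hs (j - 1)
    have e2 := sq_add_mul_nonneg hs (j + 1)
    have t1 : 2 * n + 1 + s + ((j - 1) ^ 2 + s * (j - 1)).toNat =
        (j ^ 2 + s * j).toNat + 2 * a := by
      zify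
      rw [Int.toNat_of_nonneg e0, Int.toNat_of_nonneg e1, ← ha]
      ring
    have t2 : 2 * n + 1 + s + ((j + 1) ^ 2 + s * (j + 1)).toNat =
        (j ^ 2 + s * j).toNat + 2 * b := by
      zify
      rw [Int.toNat_of_nonneg e0, Int.toNat_of_nonneg e2, ← hb]
      ring
    have u1 := congrArg (fun k => (X : ℤ⟦X⟧) ^ k) t1
    have u2 := congrArg (fun k => (X : ℤ⟦X⟧) ^ k) t2
    simp only [pow_add _ (2 * n + 1 + s), pow_add _ (j ^ 2 + s * j).toNat] at u1 u2
    simp only [finiteTerm]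
    rw [show ((n + 1 : ℕ) : ℤ) - j = a by push_cast; omega,
      show ((n + 1 : ℕ) : ℤ) + s + j = b by push_cast; omega,
      show (n : ℤ) - j = a - 1 by omega, show (n : ℤ) + s + j = b - 1 by omega,
      show (n : ℤ) - (j - 1) = a by omega, show (n : ℤ) + s + (j - 1) = b - 2 by omega,
      show (n : ℤ) - (j + 1) = a - 2 by omega, show (n : ℤ) + s + (j + 1) = b by omega]
    linear_combination X ^ (j ^ 2 + s * j).toNat * hrec -
      invPoch a * invPoch (b - 2) * u1 - invPoch (a - 2) * invPoch b * u2
  · rw [finiteTerm_eq_zero hj]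
    rw [Finset.mem_Icc] at hj
    push_cast at hj
    rw [finiteTerm_eq_zero (n := n) (j := j) (by rw [Finset.mem_Icc]; omega),
      finiteTerm_eq_zero (n := n) (j := j - 1) (by rw [Finset.mem_Icc]; omega),
      finiteTerm_eq_zero (n := n) (j := j + 1) (by rw [Finset.mem_Icc]; omega)]
    ring

/-- The finite theta sum with weights `w`. -/
noncomputable def finiteTheta (w : ℤ → ℤ) (s n : ℕ) : ℤ⟦X⟧ := ∑ᶠ j : ℤ, C (w j) * finiteTerm s n j

theorem finite_support_finiteTerm (s n : ℕ) (v : ℤ → ℤ⟦X⟧) :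
    (Function.support fun j => v j * finiteTerm s n j).Finite :=
  (Finset.finite_toSet (Finset.Icc (-(n + s) : ℤ) n)).subset fun j hj => by
    by_contra h
    exact hj (by simp only [finiteTerm_eq_zero h, mul_zero])

/-- For weights with `w (j + 1) + w (j - 1) = t w j`, such as `w j = z ^ j` with `t = z + z⁻¹`,
passing from `n` to `n + 1` multiplies the finite theta sum by one factor of the triple product. -/
theorem finiteTheta_succ {w : ℤ → ℤ} {t : ℤ} (hw : ∀ j, w (j + 1) + w (j - 1) = t * w j) {s : ℕ}
    (hs : s ≤ 1) (n : ℕ) :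
    (1 - X ^ (2 * (2 * n + 1 + s))) * (1 - X ^ (2 * (2 * n + 2 + s))) * finiteTheta w s (n + 1) =
      (1 + C t * X ^ (2 * n + 1 + s) + X ^ (2 * (2 * n + 1 + s))) * finiteTheta w s n := by
  have hfin := finite_support_finiteTerm s n
  have s1 : ∑ᶠ j : ℤ, C (w (j + 1)) * finiteTerm s n j =
      ∑ᶠ j : ℤ, C (w j) * finiteTerm s n (j - 1) := by
    rw [← finsum_comp_equiv (Equiv.addRight (1 : ℤ))
      (f := fun j => C (w j) * finiteTerm s n (j - 1))]
    exact finsum_congr fun j => by simp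
  have s2 : ∑ᶠ j : ℤ, C (w (j - 1)) * finiteTerm s n j =
      ∑ᶠ j : ℤ, C (w j) * finiteTerm s n (j + 1) := by
    rw [← finsum_comp_equiv (Equiv.subRight (1 : ℤ))
      (f := fun j => C (w j) * finiteTerm s n (j + 1))]
    exact finsum_congr fun j => by simp
  have f1 : (Function.support fun j => C (w j) * finiteTerm s n (j - 1)).Finite := by
    refine ((hfin fun j => C (w (j + 1))).preimage
      (sub_left_injective (b := (1 : ℤ))).injOn).subset ?_
    intro j hj
    simpa using hj
  have f2 : (Function.support fun j => C (w j) * finiteTerm s n (j + 1)).Finite := by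
    refine ((hfin fun j => C (w (j - 1))).preimage (add_left_injective (1 : ℤ)).injOn).subset ?_
    intro j hj
    simpa using hj
  have hmul : ∀ (c : ℤ⟦X⟧) (u : ℤ → ℤ⟦X⟧), u.support.Finite →
      c * ∑ᶠ j, u j = ∑ᶠ j, c * u j := fun c u hu => mul_finsum' u c hu
  have hadd : C t * finiteTheta w s n = ∑ᶠ j : ℤ, C (w j) * finiteTerm s n (j - 1) +
      ∑ᶠ j : ℤ, C (w j) * finiteTerm s n (j + 1) := by
    rw [← s1, ← s2, ← finsum_add_distrib (hfin _) (hfin _), finiteTheta, hmul _ _ (hfin _)]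
    refine finsum_congr fun j => ?_
    rw [← add_mul, ← map_add, hw, map_mul, mul_assoc]
  have hfin' : ∀ (c : ℤ⟦X⟧) (u : ℤ → ℤ⟦X⟧), u.support.Finite →
      (Function.support fun j => c * u j).Finite := fun c u hu => hu.subset fun j hj => by
    intro h0
    exact hj (by simp only [h0, mul_zero])
  calc
    _ = ∑ᶠ j : ℤ, ((1 + X ^ (2 * (2 * n + 1 + s))) * (C (w j) * finiteTerm s n j) +
        X ^ (2 * n + 1 + s) * (C (w j) * finiteTerm s n (j - 1)) +
        X ^ (2 * n + 1 + s) * (C (w j) * finiteTerm s n (j + 1))) := by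
        rw [finiteTheta, hmul _ _ (finite_support_finiteTerm _ _ _)]
        refine finsum_congr fun j => ?_
        linear_combination C (w j) * finiteTerm_recurrence hs n j
    _ = (1 + X ^ (2 * (2 * n + 1 + s))) * finiteTheta w s n +
        X ^ (2 * n + 1 + s) * ∑ᶠ j : ℤ, C (w j) * finiteTerm s n (j - 1) +
        X ^ (2 * n + 1 + s) * ∑ᶠ j : ℤ, C (w j) * finiteTerm s n (j + 1) := by
        have g0 := hfin' (1 + X ^ (2 * (2 * n + 1 + s))) _ (hfin fun j => C (w j))
        have g1 := hfin' (X ^ (2 * n + 1 + s)) _ f1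
        have g2 := hfin' (X ^ (2 * n + 1 + s)) _ f2
        rw [finsum_add_distrib ((g0.union g1).subset (Function.support_add _ _)) g2,
          finsum_add_distrib g0 g1, finiteTheta, hmul _ _ (hfin _), hmul _ _ f1, hmul _ _ f2]
    _ = _ := by linear_combination (-X ^ (2 * n + 1 + s)) * hadd

/-- The finite triple product. -/
theorem finiteTheta_eq {w : ℤ → ℤ} {t : ℤ} (hw : ∀ j, w (j + 1) + w (j - 1) = t * w j) {s : ℕ}
    (hs : s ≤ 1) (n : ℕ) :
    finiteTheta w s n * eulerPartial 2 (2 * n + s) = finiteTheta w s 0 * eulerPartial 2 s *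
      ∏ i ∈ Finset.range n, (1 + C t * X ^ (2 * i + 1 + s) + X ^ (2 * (2 * i + 1 + s))) := by
  induction n with
  | zero => simp
  | succ n ih =>
    rw [Finset.prod_range_succ, ← mul_assoc, ← ih,
      show 2 * (n + 1) + s = 2 * n + s + 1 + 1 by ring, eulerPartial_succ, eulerPartial_succ]
    have h := finiteTheta_succ hw hs n
    rw [show 2 * n + s + 1 = 2 * n + 1 + s by ring, show 2 * n + 1 + s + 1 = 2 * n + 2 + s by ring]
    linear_combination eulerPartial 2 (2 * n + s) * h

theorem finiteFibers_sq_add {s : ℕ} (hs : s ≤ 1) :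
    FiniteFibers fun j : ℤ => (j ^ 2 + s * j).toNat := fun n => by
  refine (Set.finite_Icc (-(n + 1) : ℤ) (n + 1)).subset fun j hj => ?_
  simp only [Set.mem_ofPred_eq, Int.toNat_le] at hj
  have : (s : ℤ) = 0 ∨ (s : ℤ) = 1 := by omega
  rcases this with h | h <;> rw [h] at hj <;> constructor <;> nlinarith

/-- The coefficient of `q ^ k` only involves the finitely many indices with exponent at most `k`, so
that the limit can be taken term by term. -/
theorem tendsto_finiteTheta (w : ℤ → ℤ) {s : ℕ} (hs : s ≤ 1) {G : ℤ⟦X⟧}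
    (hG : Tendsto invPartial atTop (𝓝 G)) :
    Tendsto (finiteTheta w s) atTop
      (𝓝 (thetaSeries (fun j : ℤ => (j ^ 2 + s * j).toNat) w * G ^ 2)) := by
  have hfin := finiteFibers_sq_add hs
  rw [WithPiTopology.tendsto_iff_coeff_tendsto]
  intro k
  set T := (hfin k).toFinset
  have hT : ∀ j, j ∉ T → k < (j ^ 2 + s * j).toNat := fun j hj => by
    simpa [T] using hj
  have h1 : ∀ n, coeff k (finiteTheta w s n) = coeff k (∑ j ∈ T, C (w j) * finiteTerm s n j) := by
    intro n
    classical
    rw [finiteTheta, finsum_eq_sum_of_support_subset (s := T ∪ Finset.Icc (-(n + s) : ℤ) n),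
      map_sum, map_sum]
    · symm
      refine Finset.sum_subset Finset.subset_union_left fun j _ hj => ?_
      rw [finiteTerm, coeff_C_mul, coeff_X_pow_mul', if_neg (by have := hT j hj; omega), mul_zero]
    · intro j hj
      rw [Finset.coe_union]
      refine Or.inr ?_
      by_contra h
      exact hj (by simp only [finiteTerm_eq_zero h, mul_zero])
  have h2 : coeff k (thetaSeries (fun j : ℤ => (j ^ 2 + s * j).toNat) w * G ^ 2) =
      coeff k (∑ j ∈ T, C (w j) * (X ^ (j ^ 2 + s * j).toNat * (G * G))) := by
    have : ∑ j ∈ T, C (w j) * (X ^ (j ^ 2 + s * j).toNat * (G * G)) =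
        (∑ j ∈ T, monomial (j ^ 2 + s * j).toNat (w j)) * G ^ 2 := by
      rw [Finset.sum_mul]
      refine Finset.sum_congr rfl fun j _ => ?_
      rw [monomial_eq_C_mul_X_pow]
      ring
    rw [this, coeff_mul, coeff_mul]
    refine Finset.sum_congr rfl fun p hp => ?_
    have := Finset.HasAntidiagonal.mem_antidiagonal.1 hp
    rw [coeff_thetaSeries_eq_coeff_sum hfin w (by omega : p.1 ≤ k)]
  simp only [h1]
  rw [h2]
  refine ((WithPiTopology.continuous_coeff ℤ k).tendsto _).comp (tendsto_finsetSum _ fun j _ => ?_)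
  have hinv : ∀ c : ℤ, Tendsto (fun n : ℕ => invPoch (n + c)) atTop (𝓝 G) := by
    intro c
    have hc : Tendsto (fun n : ℕ => ((n : ℤ) + c).toNat) atTop atTop := by
      refine tendsto_atTop.2 fun b => ?_
      filter_upwards [eventually_ge_atTop (b + c.natAbs)] with n hn
      omega
    refine (hG.comp hc).congr' ?_
    filter_upwards [eventually_ge_atTop c.natAbs] with n hn
    rw [invPoch, if_neg (by omega)]
    rfl
  have ha := hinv (-j)
  have hb := hinv (s + j)
  simp only [← sub_eq_add_neg, ← add_assoc] at ha hb
  exact ((ha.mul hb).const_mul _).const_mul _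

/-- The Jacobi triple product, in a form that allows for any solution `w` of the recurrence that
characterizes `z ^ j` and its derivatives. -/
theorem thetaSeries_mul_eulerProd {w : ℤ → ℤ} {t : ℤ}
    (hw : ∀ j, w (j + 1) + w (j - 1) = t * w j) {s : ℕ} (hs : s ≤ 1) {L : ℤ⟦X⟧}
    (hL : Tendsto (fun n => (∏ i ∈ Finset.range n,
      (1 + C t * X ^ (2 * i + 1 + s) + X ^ (2 * (2 * i + 1 + s)))) * eulerPartial 2 n ^ 2)
      atTop (𝓝 L)) :
    thetaSeries (fun j : ℤ => (j ^ 2 + s * j).toNat) w * eulerProd 2 =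
      finiteTheta w s 0 * eulerPartial 2 s * L := by
  obtain ⟨G, hG, hG1⟩ := exists_tendsto_invPartial
  have hE := tendsto_eulerPartial two_pos
  have hc : Tendsto (fun n => 2 * n + s) atTop atTop :=
    tendsto_atTop_mono (fun n => by omega : ∀ n, n ≤ 2 * n + s) tendsto_id
  have h1 := ((tendsto_finiteTheta w hs hG).mul (hE.comp hc)).mul (hE.pow 2)
  have h2 := hL.const_mul (finiteTheta w s 0 * eulerPartial 2 s)
  have h3 := tendsto_nhds_unique h1 (h2.congr fun n => by
    rw [← mul_assoc, ← finiteTheta_eq hw hs]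
    rfl)
  rw [← h3]
  linear_combination (-thetaSeries (fun j : ℤ => (j ^ 2 + s * j).toNat) w * eulerProd 2 *
    (eulerProd 2 * G + 1)) * hG1

theorem finiteTheta_zero_zero (w : ℤ → ℤ) :
    finiteTheta w 0 0 * eulerPartial 2 0 = C (w 0) := by
  have h : finiteTheta w 0 0 = ∑ j ∈ Finset.Icc (-((0 : ℕ) + (0 : ℕ)) : ℤ) (0 : ℕ),
      C (w j) * finiteTerm 0 0 j := finsum_eq_sum_of_support_subset _ fun j hj => by
    by_contra h
    exact hj (by simp only [finiteTerm_eq_zero h, mul_zero])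
  have h0 := eulerPartial_mul_invPartial 0
  simp only [eulerPartial, Finset.range_zero, Finset.prod_empty, one_mul] at h0
  rw [h]
  simp [finiteTerm, eulerPartial, invPoch, h0]

theorem finiteTheta_one_zero (w : ℤ → ℤ) :
    finiteTheta w 1 0 * eulerPartial 2 1 = C (w (-1) + w 0) := by
  have h : finiteTheta w 1 0 = ∑ j ∈ Finset.Icc (-((0 : ℕ) + (1 : ℕ)) : ℤ) (0 : ℕ),
      C (w j) * finiteTerm 1 0 j := finsum_eq_sum_of_support_subset _ fun j hj => by
    by_contra h
    exact hj (by simp only [finiteTerm_eq_zero h, mul_zero])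
  have h0 := eulerPartial_mul_invPartial 0
  have h1 := eulerPartial_mul_invPartial 1
  simp only [eulerPartial, Finset.range_zero, Finset.prod_empty, one_mul] at h0
  have hs : Finset.Icc (-1 : ℤ) 0 = {-1, 0} := by decide
  rw [h]
  simp [finiteTerm, invPoch, h0, hs, add_mul, mul_assoc, mul_comm (invPartial 1), h1]

end TripleProduct

/-! ### One-variable theta series as products -/

section ThetaProducts

open Filter Topology
open scoped PowerSeries.WithPiTopology

/-- The sign `(-1) ^ j`, for an integer `j`. -/
def altSign (j : ℤ) : ℤ := j.negOnePow

theorem altSign_add (i j : ℤ) : altSign (i + j) = altSign i * altSign j := by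
  simp [altSign, Int.negOnePow_add]

theorem altSign_neg (i : ℤ) : altSign (-i) = altSign i := by
  simp [altSign]

@[simp] theorem altSign_zero : altSign 0 = 1 := by simp [altSign]

@[simp] theorem altSign_one : altSign 1 = -1 := by simp [altSign]

theorem altSign_sub (i j : ℤ) : altSign (i - j) = altSign i * altSign j := by
  rw [sub_eq_add_neg, altSign_add, altSign_neg]

theorem altSign_mul_self (i : ℤ) : altSign i * altSign i = 1 := by
  rcases Int.units_eq_one_or i.negOnePow with h | h <;> simp [altSign, h]

/-- The triangular number `j (j + 1) / 2`. -/
def triangular (j : ℤ) : ℕ := (j * (j + 1) / 2).toNat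

theorem two_mul_triangular (j : ℤ) : 2 * (triangular j : ℤ) = j * (j + 1) := by
  have h0 : 0 ≤ j * (j + 1) := by rcases le_or_gt 0 j with h | h <;> nlinarith
  rw [triangular, Int.toNat_of_nonneg (Int.ediv_nonneg h0 (by norm_num))]
  exact Int.two_mul_ediv_two_of_even (Int.even_mul_succ_self j)

theorem triangular_neg_one_sub (j : ℤ) : triangular (-1 - j) = triangular j := by
  have h1 := two_mul_triangular j
  have h2 := two_mul_triangular (-1 - j)
  zify
  linarith

/-- The square of an integer as a natural number. -/
def sqNat (j : ℤ) : ℕ := (j ^ 2).toNat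

theorem natCast_sqNat (j : ℤ) : (sqNat j : ℤ) = j ^ 2 := Int.toNat_of_nonneg (sq_nonneg j)

/-- The exponent `m (3 m + 2)`. -/
def octagonal (m : ℤ) : ℕ := (m * (3 * m + 2)).toNat

theorem natCast_octagonal (m : ℤ) : (octagonal m : ℤ) = m * (3 * m + 2) :=
  Int.toNat_of_nonneg (by rcases le_or_gt 0 m with h | h <;> nlinarith)

/-- The generalized pentagonal number `m (3 m + 1) / 2`. -/
def pentagonalNeg (m : ℤ) : ℕ := pentagonal (-m)

theorem two_mul_pentagonalNeg (m : ℤ) : 2 * (pentagonalNeg m : ℤ) = m * (3 * m + 1) :=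
  two_mul_natCast_pentagonal_neg m

theorem finiteFibers_triangular : FiniteFibers triangular := fun n => by
  refine (Set.finite_Icc (-(2 * n + 1) : ℤ) (2 * n + 1)).subset fun j hj => ?_
  simp only [Set.mem_ofPred_eq] at hj
  have := two_mul_triangular j
  zify at hj
  constructor <;> nlinarith

theorem finiteFibers_sqNat : FiniteFibers sqNat := fun n => by
  refine (Set.finite_Icc (-n : ℤ) n).subset fun j hj => ?_
  simp only [Set.mem_ofPred_eq] at hj
  have := natCast_sqNat j
  zify at hj
  constructor <;> nlinarith

theorem finiteFibers_octagonal : FiniteFibers octagonal := fun n => by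
  refine (Set.finite_Icc (-(n + 1) : ℤ) (n + 1)).subset fun j hj => ?_
  simp only [Set.mem_ofPred_eq] at hj
  have := natCast_octagonal j
  zify at hj
  constructor <;> nlinarith

theorem finiteFibers_pentagonalNeg : FiniteFibers pentagonalNeg := fun n => by
  refine (Set.finite_Icc (-(2 * n + 1) : ℤ) (2 * n + 1)).subset fun j hj => ?_
  simp only [Set.mem_ofPred_eq] at hj
  have := two_mul_pentagonalNeg j
  zify at hj
  constructor <;> nlinarith

theorem FiniteFibers.const_mul {ι : Type*} {e : ι → ℕ} (h : FiniteFibers e) {r : ℕ} (hr : r ≠ 0) :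
    FiniteFibers fun i => r * e i := fun n => by
  refine (h n).subset fun i hi => ?_
  simp only [Set.mem_ofPred_eq] at hi ⊢
  exact (Nat.le_mul_of_pos_left _ (Nat.pos_of_ne_zero hr)).trans hi

/-- Euler's pentagonal number theorem. -/
theorem thetaSeries_pentagonalNeg : thetaSeries pentagonalNeg altSign = eulerProd 1 := by
  have h : eulerProd 1 = pentagonalSeries ℤ := by
    rw [← WithPiTopology.tprod_one_sub_X_pow, eulerProd]
    simp
  rw [h]
  ext n
  by_cases hn : ∃ k, pentagonal k = n
  · obtain ⟨k, rfl⟩ := hn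
    rw [coeff_pentagonalSeries_pentagonal, coeff_thetaSeries_eq_sum (s := {-k})]
    · simp [pentagonalNeg, altSign, -Int.coe_negOnePow]
    · intro i hi
      have := pentagonal_injective hi
      simp
      omega
  · rw [coeff_pentagonalSeries_eq_zero ℤ (by simpa using hn),
      coeff_thetaSeries_eq_zero fun i (hi : pentagonalNeg i = n) => absurd ⟨-i, hi⟩ hn]

theorem sq_add_one_mul (j : ℤ) : (j ^ 2 + (1 : ℕ) * j).toNat = 2 * triangular j := by
  have h := two_mul_triangular j
  have h0 := Int.toNat_of_nonneg (sq_add_mul_nonneg le_rfl j)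
  push_cast at h0 ⊢
  zify
  linarith

theorem sq_add_zero_mul (j : ℤ) : (j ^ 2 + (0 : ℕ) * j).toNat = sqNat j := by
  simp [sqNat]

/-- Jacobi's formula for the cube of Euler's product; each term occurs twice, for `j` and
`-1 - j`. -/
theorem thetaSeries_triangular_cube :
    thetaSeries triangular (fun j => altSign j * (2 * j + 1)) = 2 * eulerProd 1 ^ 3 := by
  have hE := tendsto_eulerPartial two_pos
  have h := thetaSeries_mul_eulerProd (w := fun j => altSign j * (2 * j + 1)) (t := -2)
    (fun j => by rw [altSign_add, altSign_sub, altSign_one]; ring) (s := 1) le_rfl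
    (L := eulerProd 2 ^ 4) ((hE.pow 4).congr fun n => by
      rw [show (4 : ℕ) = 2 + 2 from rfl, pow_add]
      congr 1
      rw [eulerPartial, ← Finset.prod_pow]
      refine Finset.prod_congr rfl fun i _ => ?_
      rw [show 2 * i + 1 + 1 = 2 * (i + 1) by ring, map_neg, map_ofNat]
      ring)
  rw [finiteTheta_one_zero] at h
  simp only [sq_add_one_mul] at h
  rw [← expand_thetaSeries two_ne_zero] at h
  apply expand_injective two_ne_zero
  rw [map_mul, map_pow, expand_eulerProd _ one_pos, mul_one, map_ofNat]
  refine mul_right_cancel₀ (eulerProd_ne_zero two_pos) (h.trans ?_)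
  have hw : altSign (-1) * (2 * -1 + 1) + altSign 0 * (2 * 0 + 1) = 2 := by
    simp [altSign_neg]
  rw [hw, map_ofNat]
  ring

/-- Gauss's formula `∑ q ^ (j (j + 1) / 2) = f₂² / f₁`; each term occurs twice, for `j` and
`-1 - j`. -/
theorem thetaSeries_triangular_mul :
    thetaSeries triangular (fun _ => (1 : ℤ)) * eulerProd 1 = 2 * eulerProd 2 ^ 2 := by
  have hE := tendsto_eulerPartial (r := 4) (by norm_num)
  have h := thetaSeries_mul_eulerProd (w := fun _ => 1) (t := 2) (fun j => by norm_num) (s := 1)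
    le_rfl (L := eulerProd 4 ^ 2) ((hE.pow 2).congr fun n => by
      rw [eulerPartial, eulerPartial, ← Finset.prod_pow, ← Finset.prod_pow,
        ← Finset.prod_mul_distrib]
      refine Finset.prod_congr rfl fun i _ => ?_
      rw [show 2 * i + 1 + 1 = 2 * (i + 1) by ring, map_ofNat]
      ring)
  rw [finiteTheta_one_zero] at h
  simp only [sq_add_one_mul] at h
  rw [← expand_thetaSeries two_ne_zero] at h
  apply expand_injective two_ne_zero
  rw [map_mul, map_mul, map_pow, expand_eulerProd _ one_pos, expand_eulerProd _ two_pos, mul_one,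
    map_ofNat, h]
  norm_num

/-- Gauss's formula `∑ (-1) ^ j q ^ (j²) = f₁² / f₂`. -/
theorem thetaSeries_sqNat_mul :
    thetaSeries sqNat altSign * eulerProd 2 = eulerProd 1 ^ 2 := by
  have hE := tendsto_eulerPartial (r := 1) one_pos
  have hc : Tendsto (fun n => 2 * n) atTop atTop :=
    tendsto_atTop_mono (fun n => by omega : ∀ n, n ≤ 2 * n) tendsto_id
  have hodd : ∀ n, (∏ i ∈ Finset.range n, (1 - X ^ (2 * i + 1) : ℤ⟦X⟧)) * eulerPartial 2 n =
      eulerPartial 1 (2 * n) := by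
    intro n
    induction n with
    | zero => simp [eulerPartial]
    | succ n ih =>
      rw [Finset.prod_range_succ, eulerPartial_succ, show 2 * (n + 1) = 2 * n + 1 + 1 by ring,
        eulerPartial_succ, eulerPartial_succ, ← ih]
      ring
  have h := thetaSeries_mul_eulerProd (w := altSign) (t := -2)
    (fun j => by rw [altSign_add, altSign_sub, altSign_one]; ring) (s := 0) zero_le_one
    (L := eulerProd 1 ^ 2) (((hE.comp hc).pow 2).congr fun n => by
      rw [Function.comp_apply, ← hodd, mul_pow, ← Finset.prod_pow]
      congr 1
      refine Finset.prod_congr rfl fun i _ => ?_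
      rw [map_neg, map_ofNat, add_zero]
      ring)
  rw [finiteTheta_zero_zero] at h
  simp only [sq_add_zero_mul] at h
  simpa using h

end ThetaProducts

/-! ### Theta series with linear weights -/

section WeightedTheta

/-- The lattice `ℤ²` as three translates of the sublattice `i ≡ j (mod 3)`. -/
def latticeSubEquiv : (ℤ × ℤ) × Fin 3 ≃ ℤ × ℤ where
  toFun p := (p.1.1 + 2 * p.1.2 + p.2, p.1.1 - p.1.2)
  invFun p := ((p.2 + (p.1 - p.2) / 3, (p.1 - p.2) / 3), ⟨((p.1 - p.2) % 3).toNat, by omega⟩)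
  left_inv := by
    rintro ⟨⟨m, l⟩, c, hc⟩
    ext <;> (simp; omega)
  right_inv := by
    rintro ⟨i, j⟩
    ext <;> simp
    omega

/-- The lattice `ℤ²` as three translates of the sublattice `i + j ≡ 0 (mod 3)`. -/
def latticeAddEquiv : (ℤ × ℤ) × Fin 3 ≃ ℤ × ℤ where
  toFun p := (p.1.1 + p.1.2, 2 * p.1.1 - p.1.2 + p.2)
  invFun p := (((p.1 + p.2) / 3, p.1 - (p.1 + p.2) / 3), ⟨((p.1 + p.2) % 3).toNat, by omega⟩)
  left_inv := by
    rintro ⟨⟨m, l⟩, c, hc⟩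
    ext <;> (simp; omega)
  right_inv := by
    rintro ⟨i, j⟩
    ext <;> simp
    omega

/-- The lattice `ℤ²` as two translates of the sublattice of even coordinate sum. -/
def latticeParityEquiv : (ℤ × ℤ) × Fin 2 ≃ ℤ × ℤ where
  toFun p := (p.1.1 + p.1.2 + p.2, p.1.1 - p.1.2)
  invFun p := (((p.1 + p.2) / 2, (p.1 + p.2) / 2 - p.2), ⟨((p.1 + p.2) % 2).toNat, by omega⟩)
  left_inv := by
    rintro ⟨⟨m, l⟩, c, hc⟩
    ext <;> (simp; omega)
  right_inv := by
    rintro ⟨i, j⟩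
    ext <;> simp
    omega

theorem thetaSeries_sqNat_linear_zero :
    thetaSeries sqNat (fun j => altSign j * (4 * j)) = 0 := by
  refine thetaSeries_eq_zero_of_antisymm (Equiv.neg ℤ) (fun j => ?_) fun j => ?_
  · simp [sqNat]
  · simp [altSign_neg]

theorem thetaSeries_triangular_alt_zero : thetaSeries triangular altSign = 0 := by
  refine thetaSeries_eq_zero_of_antisymm (Equiv.subLeft (-1)) (fun j => ?_) fun j => ?_
  · simp [triangular_neg_one_sub]
  · simp [altSign_sub, altSign_neg]

theorem ofNat_powerSeries_ne_zero (n : ℕ) [n.AtLeastTwo] : (OfNat.ofNat n : ℤ⟦X⟧) ≠ 0 := fun h =>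
  OfNat.ofNat_ne_zero (R := ℤ) n
    (by rw [← map_ofNat (constantCoeff (R := ℤ)) n, h, map_zero])

/-- The first formula of quintuple product type: `∑ (6 m + 1) q ^ (m (3 m + 1) / 2) = f₁⁵ / f₂²`.
The product of the series for `f₁³` and `f₁² / f₂` is a sum over `ℤ²`, which is split according to
`i - j` modulo `3`. -/
theorem thetaSeries_pentagonalNeg_linear_mul :
    thetaSeries pentagonalNeg (fun m => 6 * m + 1) * eulerProd 2 ^ 2 = eulerProd 1 ^ 5 := by
  have hT := finiteFibers_triangular
  have hS := finiteFibers_sqNat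
  have hP := finiteFibers_pentagonalNeg
  have hP2 := hP.const_mul two_ne_zero
  have hTS := hT.prod hS
  have h1 : thetaSeries triangular (fun j => altSign j * (2 * j + 1)) * thetaSeries sqNat altSign =
      thetaSeries (fun p : ℤ × ℤ => triangular p.1 + sqNat p.2) fun p =>
        altSign p.1 * altSign p.2 * (2 * (p.1 + 2 * p.2) + 1) := by
    -- adding this vanishing series turns the weight into a function of `i + 2 j`, which
    -- does not depend on the parameter `l` of `latticeSubEquiv`
    have h0 : thetaSeries (fun p : ℤ × ℤ => triangular p.1 + sqNat p.2)
        (fun p => altSign p.1 * (altSign p.2 * (4 * p.2))) = 0 := by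
      rw [← thetaSeries_mul hT hS altSign fun j => altSign j * (4 * j),
        thetaSeries_sqNat_linear_zero, mul_zero]
    rw [thetaSeries_mul hT hS, ← add_zero (thetaSeries _ _), ← h0, ← thetaSeries_add hTS]
    congr 1
    funext p
    ring
  have h2 : thetaSeries pentagonalNeg (fun m => 6 * m + 1) * eulerProd 2 =
      thetaSeries (fun p : ℤ × ℤ => pentagonalNeg p.1 + 2 * pentagonalNeg p.2) fun p =>
        (6 * p.1 + 1) * altSign p.2 := by
    rw [← thetaSeries_mul hP hP2 (fun m => 6 * m + 1) altSign,
      ← expand_thetaSeries two_ne_zero, thetaSeries_pentagonalNeg,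
      expand_eulerProd _ one_pos, mul_one]
  have h3 : thetaSeries triangular (fun j => altSign j * (2 * j + 1)) * thetaSeries sqNat altSign =
      2 * (thetaSeries pentagonalNeg (fun m => 6 * m + 1) * eulerProd 2) := by
    rw [h1, ← thetaSeries_congr latticeSubEquiv (fun _ => rfl) (fun _ => rfl),
      thetaSeries_prod_fin_three (FiniteFibers.of_equiv latticeSubEquiv (fun _ => rfl) hTS)]
    have c0 : thetaSeries (fun i : ℤ × ℤ => triangular (latticeSubEquiv (i, 0)).1 +
        sqNat (latticeSubEquiv (i, 0)).2) (fun i => altSign (latticeSubEquiv (i, 0)).1 *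
        altSign (latticeSubEquiv (i, 0)).2 *
        (2 * ((latticeSubEquiv (i, 0)).1 + 2 * (latticeSubEquiv (i, 0)).2) + 1)) =
        thetaSeries pentagonalNeg (fun m => 6 * m + 1) * eulerProd 2 := by
      rw [h2]
      refine thetaSeries_congr (Equiv.refl _) ?_ ?_
      · rintro ⟨m, l⟩
        have e1 := two_mul_triangular (m + 2 * l)
        have e2 := natCast_sqNat (m - l)
        have e3 := two_mul_pentagonalNeg m
        have e4 := two_mul_pentagonalNeg l
        simp [latticeSubEquiv]
        zify
        linarith
      · rintro ⟨m, l⟩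
        simp [latticeSubEquiv, altSign_add, altSign_sub, two_mul, altSign_mul_self]
        linear_combination (-(6 * m + 1) * altSign l) * altSign_mul_self m
    have c1 : thetaSeries (fun i : ℤ × ℤ => triangular (latticeSubEquiv (i, 1)).1 +
        sqNat (latticeSubEquiv (i, 1)).2) (fun i => altSign (latticeSubEquiv (i, 1)).1 *
        altSign (latticeSubEquiv (i, 1)).2 *
        (2 * ((latticeSubEquiv (i, 1)).1 + 2 * (latticeSubEquiv (i, 1)).2) + 1)) = 0 := by
      refine thetaSeries_eq_zero_of_antisymm
        (Equiv.prodCongr (Equiv.refl _) (Equiv.subLeft (-1))) ?_ ?_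
      · rintro ⟨m, l⟩
        have e1 := two_mul_triangular (m + 2 * l + 1)
        have e2 := natCast_sqNat (m - l)
        have e3 := two_mul_triangular (m + 2 * (-1 - l) + 1)
        have e4 := natCast_sqNat (m - (-1 - l))
        simp [latticeSubEquiv]
        zify
        linarith
      · rintro ⟨m, l⟩
        simp [latticeSubEquiv, altSign_add, altSign_sub, two_mul, altSign_mul_self, altSign_neg]
        exact Or.inl (by ring)
    have c2 : thetaSeries (fun i : ℤ × ℤ => triangular (latticeSubEquiv (i, 2)).1 +
        sqNat (latticeSubEquiv (i, 2)).2) (fun i => altSign (latticeSubEquiv (i, 2)).1 *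
        altSign (latticeSubEquiv (i, 2)).2 *
        (2 * ((latticeSubEquiv (i, 2)).1 + 2 * (latticeSubEquiv (i, 2)).2) + 1)) =
        thetaSeries pentagonalNeg (fun m => 6 * m + 1) * eulerProd 2 := by
      rw [h2]
      refine thetaSeries_congr (Equiv.prodCongr (Equiv.subLeft (-1)) (Equiv.subLeft (-1))) ?_ ?_
      · rintro ⟨m, l⟩
        have e1 := two_mul_triangular (m + 2 * l + 2)
        have e2 := natCast_sqNat (m - l)
        have e3 := two_mul_pentagonalNeg (-1 - m)
        have e4 := two_mul_pentagonalNeg (-1 - l)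
        simp [latticeSubEquiv]
        zify
        linarith
      · rintro ⟨m, l⟩
        have e2 : altSign 2 = 1 := by decide
        simp [latticeSubEquiv, altSign_add, altSign_sub, two_mul, altSign_mul_self, altSign_neg, e2]
        linear_combination (-(6 * m + 5) * altSign l) * altSign_mul_self m
    rw [c0, c1, c2]
    ring
  rw [thetaSeries_triangular_cube] at h3
  have h4 := thetaSeries_sqNat_mul
  refine mul_left_cancel₀ (ofNat_powerSeries_ne_zero 2) ?_
  linear_combination (-eulerProd 2) * h3 + 2 * eulerProd 1 ^ 3 * h4

/-- The second formula of quintuple product type: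
`∑ (-1) ^ m (3 m + 1) q ^ (m (3 m + 2)) = f₂⁵ / f₁²`. The product of the series for `f₂³` and
`f₂² / f₁` is a sum over `ℤ²`, which is split according to `i + j` modulo `3`. -/
theorem thetaSeries_octagonal_linear_mul :
    thetaSeries octagonal (fun m => altSign m * (3 * m + 1)) * eulerProd 1 ^ 2 =
      eulerProd 2 ^ 5 := by
  have hT := finiteFibers_triangular
  have hT2 := hT.const_mul two_ne_zero
  have hP := finiteFibers_pentagonalNeg
  have hO := finiteFibers_octagonal
  have hTT := hT2.prod hT
  have h1 : thetaSeries (fun j => 2 * triangular j) (fun j => altSign j * (2 * j + 1)) *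
      thetaSeries triangular (fun _ => (1 : ℤ)) =
      thetaSeries (fun p : ℤ × ℤ => 2 * triangular p.1 + triangular p.2) fun p =>
        2 * (altSign p.1 * (p.1 + p.2 + 1)) := by
    -- adding this vanishing series turns the weight into a function of `i + j`, which does not
    -- depend on the parameter `l` of `latticeAddEquiv`
    have h0 : thetaSeries (fun p : ℤ × ℤ => 2 * triangular p.1 + triangular p.2)
        (fun p => altSign p.1 * (2 * p.2 + 1)) = 0 := by
      rw [← thetaSeries_mul hT2 hT altSign fun j => 2 * j + 1, ← expand_thetaSeries two_ne_zero,
        thetaSeries_triangular_alt_zero, map_zero, zero_mul]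
    rw [thetaSeries_mul hT2 hT, ← add_zero (thetaSeries _ _), ← h0, ← thetaSeries_add hTT]
    congr 1
    funext p
    ring
  have h2 : thetaSeries octagonal (fun m => altSign m * (3 * m + 1)) * eulerProd 1 =
      thetaSeries (fun p : ℤ × ℤ => octagonal p.1 + pentagonalNeg p.2) fun p =>
        altSign p.1 * (3 * p.1 + 1) * altSign p.2 := by
    rw [← thetaSeries_mul hO hP (fun m => altSign m * (3 * m + 1)) altSign,
      thetaSeries_pentagonalNeg]
  have h3 : thetaSeries (fun j => 2 * triangular j) (fun j => altSign j * (2 * j + 1)) *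
      thetaSeries triangular (fun _ => (1 : ℤ)) =
      4 * (thetaSeries octagonal (fun m => altSign m * (3 * m + 1)) * eulerProd 1) := by
    rw [h1, thetaSeries_const_mul hTT,
      ← thetaSeries_congr latticeAddEquiv (fun _ => rfl) (fun _ => rfl),
      thetaSeries_prod_fin_three (FiniteFibers.of_equiv latticeAddEquiv (fun _ => rfl) hTT)]
    have c0 : thetaSeries (fun i : ℤ × ℤ => 2 * triangular (latticeAddEquiv (i, 0)).1 +
        triangular (latticeAddEquiv (i, 0)).2) (fun i => altSign (latticeAddEquiv (i, 0)).1 *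
        ((latticeAddEquiv (i, 0)).1 + (latticeAddEquiv (i, 0)).2 + 1)) =
        thetaSeries octagonal (fun m => altSign m * (3 * m + 1)) * eulerProd 1 := by
      rw [h2]
      refine thetaSeries_congr (Equiv.refl _) ?_ ?_
      · rintro ⟨m, l⟩
        have e1 := two_mul_triangular (m + l)
        have e2 := two_mul_triangular (2 * m - l)
        have e3 := natCast_octagonal m
        have e4 := two_mul_pentagonalNeg l
        simp [latticeAddEquiv]
        zify
        linarith
      · rintro ⟨m, l⟩
        simp [latticeAddEquiv, altSign_add]
        ring
    have c1 : thetaSeries (fun i : ℤ × ℤ => 2 * triangular (latticeAddEquiv (i, 1)).1 +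
        triangular (latticeAddEquiv (i, 1)).2) (fun i => altSign (latticeAddEquiv (i, 1)).1 *
        ((latticeAddEquiv (i, 1)).1 + (latticeAddEquiv (i, 1)).2 + 1)) =
        thetaSeries octagonal (fun m => altSign m * (3 * m + 1)) * eulerProd 1 := by
      rw [h2]
      refine thetaSeries_congr (Equiv.prodCongr (Equiv.subLeft (-1)) (Equiv.neg ℤ)) ?_ ?_
      · rintro ⟨m, l⟩
        have e1 := two_mul_triangular (m + l)
        have e2 := two_mul_triangular (2 * m - l + 1)
        have e3 := natCast_octagonal (-1 - m)
        have e4 := two_mul_pentagonalNeg (-l)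
        simp [latticeAddEquiv]
        zify
        linarith
      · rintro ⟨m, l⟩
        simp [latticeAddEquiv, altSign_add, altSign_sub, altSign_neg]
        ring
    have c2 : thetaSeries (fun i : ℤ × ℤ => 2 * triangular (latticeAddEquiv (i, 2)).1 +
        triangular (latticeAddEquiv (i, 2)).2) (fun i => altSign (latticeAddEquiv (i, 2)).1 *
        ((latticeAddEquiv (i, 2)).1 + (latticeAddEquiv (i, 2)).2 + 1)) = 0 := by
      refine thetaSeries_eq_zero_of_antisymm
        (Equiv.prodCongr (Equiv.refl _) (Equiv.subLeft 1)) ?_ ?_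
      · rintro ⟨m, l⟩
        have e1 := two_mul_triangular (m + l)
        have e2 := two_mul_triangular (2 * m - l + 2)
        have e3 := two_mul_triangular (m + (1 - l))
        have e4 := two_mul_triangular (2 * m - (1 - l) + 2)
        simp [latticeAddEquiv]
        zify
        linarith
      · rintro ⟨m, l⟩
        simp [latticeAddEquiv, altSign_add, altSign_sub]
        exact Or.inl (by ring)
    rw [c0, c1, c2, map_ofNat]
    ring
  rw [← expand_thetaSeries two_ne_zero, thetaSeries_triangular_cube, map_mul, map_pow, map_ofNat,
    expand_eulerProd _ one_pos, mul_one] at h3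
  have h4 := thetaSeries_triangular_mul
  refine mul_left_cancel₀ (ofNat_powerSeries_ne_zero 4) ?_
  linear_combination (-eulerProd 1) * h3 + 2 * eulerProd 2 ^ 3 * h4

end WeightedTheta

/-! ### The product `f₁⁴ f₂²` -/

section FourTwo

theorem rescale_neg_one_expand_two (F : ℤ⟦X⟧) :
    rescale (-1) (expand 2 two_ne_zero F) = expand 2 two_ne_zero F := by
  ext n
  rw [coeff_rescale, coeff_expand]
  split_ifs with h
  · rw [(even_iff_two_dvd.2 h).neg_one_pow, one_mul]
  · rw [mul_zero]

theorem altSign_eq_neg_one_pow {j : ℤ} {n : ℕ} (h : Even (j - n)) : altSign j = (-1) ^ n := by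
  have h1 : altSign (j - n) = 1 := by simp [altSign, Int.negOnePow_even _ h, -Int.coe_negOnePow]
  have h2 : altSign n = (-1) ^ n := by
    rw [altSign, Int.negOnePow_def, zpow_natCast, Units.val_pow_eq_pow_val]
    rfl
  rw [← h2, ← sub_add_cancel j n, altSign_add, h1, one_mul]

theorem rescale_thetaSeries_sqNat :
    rescale (-1) (thetaSeries sqNat altSign) = thetaSeries sqNat fun _ => (1 : ℤ) := by
  rw [rescale_thetaSeries _ finiteFibers_sqNat]
  congr 1
  funext j
  rw [← altSign_eq_neg_one_pow (j := j), altSign_mul_self]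
  rw [natCast_sqNat, show j - j ^ 2 = -(j * (j - 1)) by ring, even_neg]
  exact Int.even_mul_pred_self j

theorem rescale_thetaSeries_octagonal :
    rescale (-1) (thetaSeries octagonal fun m => altSign m * (3 * m + 1)) =
      thetaSeries octagonal fun m => 3 * m + 1 := by
  rw [rescale_thetaSeries _ finiteFibers_octagonal]
  congr 1
  funext j
  rw [← altSign_eq_neg_one_pow (j := j), ← mul_assoc, altSign_mul_self, one_mul]
  rw [natCast_octagonal, show j - j * (3 * j + 2) = -(j * (j + 1) + 2 * j ^ 2) by ring, even_neg]
  exact (Int.even_mul_succ_self j).add (even_two_mul _)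

/-- `φ(q) φ(-q) = φ(-q²)²`. -/
theorem thetaSeries_sqNat_mul_alt :
    thetaSeries sqNat (fun _ => (1 : ℤ)) * thetaSeries sqNat altSign =
      expand 2 two_ne_zero (thetaSeries sqNat altSign) ^ 2 := by
  have hS := finiteFibers_sqNat
  have hS2 := hS.const_mul two_ne_zero
  have hSS := hS.prod hS
  rw [thetaSeries_mul hS hS, expand_thetaSeries, sq, thetaSeries_mul hS2 hS2,
    ← thetaSeries_congr latticeParityEquiv (fun _ => rfl) (fun _ => rfl),
    thetaSeries_prod_fin_two (FiniteFibers.of_equiv latticeParityEquiv (fun _ => rfl) hSS)]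
  have c1 : thetaSeries (fun i : ℤ × ℤ => sqNat (latticeParityEquiv (i, 1)).1 +
      sqNat (latticeParityEquiv (i, 1)).2)
      (fun i => 1 * altSign (latticeParityEquiv (i, 1)).2) = 0 := by
    refine thetaSeries_eq_zero_of_antisymm
      (Equiv.prodCongr (Equiv.subLeft (-1)) (Equiv.refl _)) ?_ ?_
    · rintro ⟨m, l⟩
      have e1 := natCast_sqNat (m + l + 1)
      have e2 := natCast_sqNat (m - l)
      have e3 := natCast_sqNat (-1 - m + l + 1)
      have e4 := natCast_sqNat (-1 - m - l)
      simp [latticeParityEquiv]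
      zify
      linarith
    · rintro ⟨m, l⟩
      simp [latticeParityEquiv, altSign_sub, altSign_neg]
  rw [c1, add_zero]
  refine thetaSeries_congr (Equiv.refl _) ?_ ?_
  · rintro ⟨m, l⟩
    have e1 := natCast_sqNat (m + l)
    have e2 := natCast_sqNat (m - l)
    have e3 := natCast_sqNat m
    have e4 := natCast_sqNat l
    simp [latticeParityEquiv]
    zify
    linarith
  · rintro ⟨m, l⟩
    simp [latticeParityEquiv, altSign_sub]

/-- The `2`-dissection `φ(-q)² = φ(q²)² - 4 q ψ(q⁴)²`; the triangular series below is `2 ψ`. -/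
theorem thetaSeries_sqNat_sq :
    thetaSeries sqNat altSign ^ 2 =
      expand 2 two_ne_zero (thetaSeries sqNat fun _ => (1 : ℤ)) ^ 2 -
        X * expand 4 four_ne_zero (thetaSeries triangular fun _ => (1 : ℤ)) ^ 2 := by
  have hS := finiteFibers_sqNat
  have hT4 := finiteFibers_triangular.const_mul four_ne_zero
  have hS2 := hS.const_mul two_ne_zero
  have hSS := hS.prod hS
  rw [expand_thetaSeries, expand_thetaSeries, sq, sq, sq, thetaSeries_mul hS hS,
    thetaSeries_mul hS2 hS2, thetaSeries_mul hT4 hT4, ← pow_one X, X_pow_mul_thetaSeries,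
    ← thetaSeries_congr latticeParityEquiv (fun _ => rfl) (fun _ => rfl),
    thetaSeries_prod_fin_two (FiniteFibers.of_equiv latticeParityEquiv (fun _ => rfl) hSS),
    sub_eq_add_neg, ← thetaSeries_neg]
  congr 1
  · refine thetaSeries_congr (Equiv.refl _) ?_ ?_
    · rintro ⟨m, l⟩
      have e1 := natCast_sqNat (m + l)
      have e2 := natCast_sqNat (m - l)
      have e3 := natCast_sqNat m
      have e4 := natCast_sqNat l
      simp [latticeParityEquiv]
      zify
      linarith
    · rintro ⟨m, l⟩
      simp [latticeParityEquiv, altSign_add, altSign_sub]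
      linear_combination (-1 : ℤ) * altSign_mul_self m - altSign m ^ 2 * altSign_mul_self l
  · refine thetaSeries_congr (Equiv.refl _) ?_ ?_
    · rintro ⟨m, l⟩
      have e1 := natCast_sqNat (m + l + 1)
      have e2 := natCast_sqNat (m - l)
      have e3 := two_mul_triangular m
      have e4 := two_mul_triangular l
      simp [latticeParityEquiv]
      zify
      linarith
    · rintro ⟨m, l⟩
      simp [latticeParityEquiv, altSign_add, altSign_sub]
      linear_combination (-1 : ℤ) * altSign_mul_self m - altSign m ^ 2 * altSign_mul_self l

/-- `f₁⁴ f₂²` as a difference of two binary theta series with weights `(6 u + 1) (6 v + 1)` and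
`4 (3 u + 1) (3 v + 1)`. -/
theorem eulerProd_four_two :
    eulerProd 1 ^ 4 * eulerProd 2 ^ 2 =
      expand 4 four_ne_zero (thetaSeries pentagonalNeg fun m => 6 * m + 1) ^ 2 -
        4 * X * expand 2 two_ne_zero (thetaSeries octagonal fun m => 3 * m + 1) ^ 2 := by
  have hA := thetaSeries_pentagonalNeg_linear_mul
  have hB := thetaSeries_octagonal_linear_mul
  have hφ := thetaSeries_sqNat_mul
  have hψ := thetaSeries_triangular_mul
  have hφφ := thetaSeries_sqNat_mul_alt
  have hsq := thetaSeries_sqNat_sq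
  have hE2 : expand 2 two_ne_zero (eulerProd 1) = eulerProd 2 := by
    rw [expand_eulerProd _ one_pos, mul_one]
  have hE4 : expand 2 two_ne_zero (eulerProd 2) = eulerProd 4 := by
    exact expand_eulerProd _ two_pos
  have hr2 : rescale (-1) (eulerProd 2) = eulerProd 2 := by
    rw [← hE2, rescale_neg_one_expand_two]
  have hφ' := congrArg (rescale (-1)) hφ
  rw [map_mul, map_pow, rescale_thetaSeries_sqNat, hr2] at hφ'
  have hB' := congrArg (rescale (-1)) hB
  rw [map_mul, map_pow, map_pow, rescale_thetaSeries_octagonal, hr2] at hB'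
  have hA2 := congrArg (expand 2 two_ne_zero) hA
  rw [map_mul, map_pow, map_pow, hE2, hE4] at hA2
  have hφ2 := congrArg (expand 2 two_ne_zero) hφ
  rw [map_mul, map_pow, hE2, hE4] at hφ2
  have hψ2 := congrArg (expand 2 two_ne_zero) hψ
  rw [map_mul, map_mul, map_pow, map_ofNat, hE2, hE4] at hψ2
  have n2 := eulerProd_ne_zero two_pos
  have n4 := eulerProd_ne_zero (r := 4) (by norm_num)
  have hexp : ∀ F : ℤ⟦X⟧, expand 4 four_ne_zero F =
      expand 2 two_ne_zero (expand 2 two_ne_zero F) := fun F => by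
    rw [← expand_mul]
  -- `A(q²) = φ(q) f₁²`
  have kA : expand 2 two_ne_zero (thetaSeries pentagonalNeg fun m => 6 * m + 1) =
      (thetaSeries sqNat fun _ => (1 : ℤ)) * eulerProd 1 ^ 2 := by
    refine mul_right_cancel₀ (pow_ne_zero 2 n4) ?_
    rw [hA2, ← hφ]
    linear_combination (-eulerProd 2 * (expand 2 two_ne_zero (thetaSeries sqNat altSign) *
      eulerProd 4 + eulerProd 2 ^ 2)) * hφ2 - eulerProd 2 * eulerProd 4 ^ 2 * hφφ
  -- `C(q) = φ(-q) f₄²`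
  have kC0 : (thetaSeries octagonal fun m => 3 * m + 1) =
      thetaSeries sqNat altSign * eulerProd 4 ^ 2 := by
    have h1 : (thetaSeries octagonal fun m => 3 * m + 1) * (thetaSeries sqNat fun _ => (1 : ℤ)) =
        eulerProd 2 ^ 4 := by
      refine mul_right_cancel₀ n2 ?_
      rw [mul_assoc, hφ', hB']
      ring
    refine mul_right_cancel₀ (pow_ne_zero 4 n2) ?_
    linear_combination (-(thetaSeries octagonal fun m => 3 * m + 1) *
      (expand 2 two_ne_zero (thetaSeries sqNat altSign) * eulerProd 4 + eulerProd 2 ^ 2)) * hφ2 -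
      (thetaSeries octagonal fun m => 3 * m + 1) * eulerProd 4 ^ 2 * hφφ +
      thetaSeries sqNat altSign * eulerProd 4 ^ 2 * h1
  -- `2 C(q) = 2 ψ(q²) f₁²`
  have kC : 2 * (thetaSeries octagonal fun m => 3 * m + 1) =
      expand 2 two_ne_zero (thetaSeries triangular fun _ => (1 : ℤ)) * eulerProd 1 ^ 2 := by
    rw [kC0, ← hφ]
    linear_combination (-thetaSeries sqNat altSign) * hψ2
  have kA' := congrArg (expand 2 two_ne_zero) kA
  have kC' := congrArg (expand 2 two_ne_zero) kC
  rw [map_mul, map_pow, ← hexp, hE2] at kA'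
  rw [map_mul, map_mul, map_pow, map_ofNat, ← hexp, hE2] at kC'
  rw [kA', show eulerProd 1 ^ 4 * eulerProd 2 ^ 2 =
    (thetaSeries sqNat altSign) ^ 2 * eulerProd 2 ^ 4 by
      rw [show eulerProd 1 ^ 4 = (eulerProd 1 ^ 2) ^ 2 by ring, ← hφ]; ring, hsq]
  linear_combination X * (expand 4 four_ne_zero (thetaSeries triangular fun _ => (1 : ℤ)) *
    eulerProd 2 ^ 2 + 2 * expand 2 two_ne_zero (thetaSeries octagonal fun m => 3 * m + 1)) * kC'

end FourTwo

/-! ### Residue classes of exponents -/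

section Residues

variable {R : Type*} [CommRing R]

/-- The part of a power series with exponents congruent to `r` modulo `p`. -/
noncomputable def residuePart (p r : ℕ) (F : R⟦X⟧) : R⟦X⟧ :=
  PowerSeries.mk fun n => if n % p = r then coeff n F else 0

theorem coeff_residuePart (p r : ℕ) (F : R⟦X⟧) (n : ℕ) :
    coeff n (residuePart p r F) = if n % p = r then coeff n F else 0 := coeff_mk _ _

theorem residuePart_eq_zero_iff {p r : ℕ} {F : R⟦X⟧} :
    residuePart p r F = 0 ↔ ∀ n, n % p = r → coeff n F = 0 := by
  constructor
  · intro h n hn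
    have := congrArg (coeff n) h
    rwa [coeff_residuePart, if_pos hn, map_zero] at this
  · intro h
    ext n
    rw [coeff_residuePart, map_zero]
    split_ifs with hn
    exacts [h n hn, rfl]

theorem residuePart_mul {p r : ℕ} (hr : r < p) (F G : R⟦X⟧) :
    residuePart p r (F * G) = ∑ s ∈ Finset.range p,
      residuePart p s F * residuePart p ((r + p - s) % p) G := by
  have hp : 0 < p := by omega
  ext n
  rw [coeff_residuePart, map_sum]
  simp only [coeff_mul, coeff_residuePart]
  rw [Finset.sum_comm]
  split_ifs with hn
  · refine Finset.sum_congr rfl fun ij hij => ?_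
    have hsum := Finset.HasAntidiagonal.mem_antidiagonal.1 hij
    have hi := Nat.mod_lt ij.1 hp
    rw [Finset.sum_eq_single (ij.1 % p)]
    · rw [if_pos rfl, if_pos]
      have h1 : (ij.1 % p + (r + p - ij.1 % p)) ≡ ij.1 % p + ij.2 [MOD p] := by
        rw [Nat.add_sub_cancel' (by omega)]
        calc r + p ≡ r [MOD p] := by simp [Nat.ModEq]
          _ ≡ n [MOD p] := by rw [← hn]; exact Nat.mod_modEq _ _
          _ = ij.1 + ij.2 := hsum.symm
          _ ≡ ij.1 % p + ij.2 [MOD p] := (Nat.mod_modEq _ _).symm.add_right _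
      exact (Nat.ModEq.add_left_cancel' _ h1).symm
    · intro s _ hs
      rw [if_neg (Ne.symm hs), zero_mul]
    · intro h
      exact absurd (Finset.mem_range.2 hi) h
  · symm
    refine Finset.sum_eq_zero fun ij hij => Finset.sum_eq_zero fun s hs => ?_
    have hsum := Finset.HasAntidiagonal.mem_antidiagonal.1 hij
    have hs' := Finset.mem_range.1 hs
    split_ifs with h1 h2 <;> try simp
    refine absurd ?_ hn
    have h3 : n ≡ r [MOD p] := by
      rw [← hsum]
      calc ij.1 + ij.2 ≡ s + (r + p - s) [MOD p] := by
            refine Nat.ModEq.add ?_ h2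
            rw [Nat.ModEq, h1, Nat.mod_eq_of_lt hs']
        _ = r + p := Nat.add_sub_cancel' (by omega)
        _ ≡ r [MOD p] := by simp [Nat.ModEq]
    rw [h3, Nat.mod_eq_of_lt hr]

theorem expand_eq_pow (p : ℕ) [hp : Fact p.Prime] (F : (ZMod p)⟦X⟧) :
    expand p hp.out.ne_zero F = F ^ p := by
  have h := MvPowerSeries.map_frobenius_expand p hp.out.ne_zero (f := F)
  rw [ZMod.frobenius_zmod] at h
  rw [← h, MvPowerSeries.map_id]
  rfl

/-- Multiplication by `p`-th powers does not mix residue classes of exponents modulo `p`. -/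
theorem residuePart_eq_zero_of_mul_pow {p r : ℕ} [hp : Fact p.Prime] {D B U V : (ZMod p)⟦X⟧}
    (hU : constantCoeff U = 1) (h : D * U ^ p = V ^ p * B) (hB : residuePart p r B = 0) :
    residuePart p r D = 0 := by
  have hinv : U * invOfUnit U 1 = 1 := mul_invOfUnit _ _ (by simpa using hU)
  have hD : D = expand p hp.out.ne_zero (V * invOfUnit U 1) * B := by
    have hinv' : U ^ p * invOfUnit U 1 ^ p = 1 := by rw [← mul_pow, hinv, one_pow]
    rw [expand_eq_pow, mul_pow]
    linear_combination invOfUnit U 1 ^ p * h - D * hinv'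
  rw [residuePart_eq_zero_iff] at hB ⊢
  intro n hn
  rw [hD, coeff_mul]
  refine Finset.sum_eq_zero fun ij hij => ?_
  have hsum := Finset.HasAntidiagonal.mem_antidiagonal.1 hij
  by_cases hd : p ∣ ij.1
  · obtain ⟨m, hm⟩ := hd
    rw [hB ij.2 (by rw [← hn, ← hsum, hm, Nat.mul_add_mod]), mul_zero]
  · rw [coeff_expand_of_not_dvd _ _ _ hd, zero_mul]

/-- The reduction of an integral power series modulo `p`. -/
noncomputable def reduceMod (p : ℕ) : ℤ⟦X⟧ →+* (ZMod p)⟦X⟧ := PowerSeries.map (Int.castRingHom _)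

theorem coeff_reduceMod (p n : ℕ) (F : ℤ⟦X⟧) :
    coeff n (reduceMod p F) = ((coeff n F : ℤ) : ZMod p) := rfl

theorem residuePart_thetaSeries_eq_zero {ι : Type*} {p r : ℕ} {e : ι → ℕ} (he : FiniteFibers e)
    {w : ι → ℤ} (h : ∀ i, ((e i : ℤ) : ZMod p) = r → ((w i : ℤ) : ZMod p) = 0) :
    residuePart p r (reduceMod p (thetaSeries e w)) = 0 := by
  rw [residuePart_eq_zero_iff, reduceMod, map_thetaSeries _ he]
  refine fun n hn => coeff_thetaSeries_eq_zero fun i hi => h i ?_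
  rw [hi, ← hn]
  simp

theorem reduceMod_expand {p r : ℕ} (hr : r ≠ 0) (F : ℤ⟦X⟧) :
    reduceMod p (expand r hr F) = expand r hr (reduceMod p F) := map_expand _ _ _ _

end Residues

/-! ### Congruences for the diamond counts -/

section Congruences

instance fact_prime_five : Fact (Nat.Prime 5) := ⟨by norm_num⟩

instance fact_prime_seven : Fact (Nat.Prime 7) := ⟨by norm_num⟩

instance fact_prime_eleven : Fact (Nat.Prime 11) := ⟨by norm_num⟩

instance fact_prime_thirteen : Fact (Nat.Prime 13) := ⟨by norm_num⟩

/-- The generating function of the number of `k`-elongated plane partition diamonds. -/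
noncomputable def diamondSeries (k : ℕ) : ℤ⟦X⟧ :=
  PowerSeries.mk fun n => (elongatedDiamondCount k n : ℤ)

theorem diamondSeries_mul (k : ℕ) :
    diamondSeries k * eulerProd 1 ^ (3 * k + 1) = eulerProd 2 ^ k := by
  have h := elongatedDiamondCount_generatingFunction k
  simpa only [diamondSeries, eulerProd, one_mul] using h

/-- If the generating function is a theta-like series `F`, up to a unit and `p`-th powers, then the
counts inherit the residue classes in which the coefficients of `F` vanish modulo `p`. -/
theorem elongatedDiamondCount_modEq_zero {p k c r : ℕ} [hp : Fact p.Prime] (hc : ¬ p ∣ c)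
    {U V F : ℤ⟦X⟧} (hU : constantCoeff U = 1) (h : c * diamondSeries k * U ^ p = V ^ p * F)
    (hF : residuePart p r (reduceMod p F) = 0) {n : ℕ} (hn : n % p = r) :
    elongatedDiamondCount k n ≡ 0 [MOD p] := by
  have h1 := congrArg (reduceMod p) h
  rw [map_mul, map_pow, map_mul _ (V ^ p), map_pow] at h1
  have hU' : constantCoeff (reduceMod p U) = 1 := by
    have := coeff_reduceMod p 0 U
    rw [coeff_zero_eq_constantCoeff_apply, coeff_zero_eq_constantCoeff_apply, hU] at this
    simpa using this
  have h2 := residuePart_eq_zero_iff.1 (residuePart_eq_zero_of_mul_pow hU' h1 hF) n hn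
  rw [coeff_reduceMod, ← map_natCast (C (R := ℤ)), coeff_C_mul, diamondSeries, coeff_mk]
    at h2
  have h3 : ((c * elongatedDiamondCount k n : ℕ) : ZMod p) = 0 := by
    push_cast at h2 ⊢
    exact h2
  rw [ZMod.natCast_eq_zero_iff] at h3
  exact (Nat.modEq_zero_iff_dvd).2 ((hp.out.dvd_mul.1 h3).resolve_left hc)

theorem residuePart_sqNat_eq_zero {p r : ℕ} (h : ∀ x : ZMod p, x ^ 2 ≠ r) :
    residuePart p r (reduceMod p (thetaSeries sqNat altSign)) = 0 :=
  residuePart_thetaSeries_eq_zero finiteFibers_sqNat fun i hi => by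
    rw [natCast_sqNat, Int.cast_pow] at hi
    exact absurd hi (h _)

theorem residuePart_triangular_eq_zero {p r : ℕ} {w : ℤ → ℤ}
    (h : ∀ i : ℤ, (2 * r : ZMod p) = i * (i + 1) → (w i : ZMod p) = 0) :
    residuePart p r (reduceMod p (thetaSeries triangular w)) = 0 :=
  residuePart_thetaSeries_eq_zero finiteFibers_triangular fun i hi => h i (by
    have := congrArg (Int.cast : ℤ → ZMod p) (two_mul_triangular i)
    push_cast at this hi ⊢
    rw [← this, hi])

theorem residuePart_pentagonalNeg_eq_zero {p r : ℕ}
    (h : ∀ x : ZMod p, 2 * r = x * (3 * x + 1) → 6 * x + 1 = 0) :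
    residuePart p r (reduceMod p (thetaSeries pentagonalNeg fun m => 6 * m + 1)) = 0 :=
  residuePart_thetaSeries_eq_zero finiteFibers_pentagonalNeg fun i hi => by
    have := congrArg (Int.cast : ℤ → ZMod p) (two_mul_pentagonalNeg i)
    push_cast at this hi ⊢
    exact h _ (by rw [← this, hi])

theorem constantCoeff_eulerProd_pow {r : ℕ} (hr : 0 < r) (m : ℕ) :
    constantCoeff (eulerProd r ^ m) = 1 := by
  rw [map_pow, constantCoeff_eulerProd hr, one_pow]

theorem eulerProd_one_ne_zero : eulerProd 1 ≠ 0 := eulerProd_ne_zero one_pos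

/-- For `k ≡ -1 (mod p)` the generating function is `φ(-q)`, up to `p`-th powers. -/
theorem modEq_zero_of_sqNat {p k b r n : ℕ} [hp : Fact p.Prime] (hk : k + 1 = p * b)
    (hr : ∀ x : ZMod p, x ^ 2 ≠ r) (hn : n % p = r) : elongatedDiamondCount k n ≡ 0 [MOD p] := by
  refine elongatedDiamondCount_modEq_zero (c := 1) (U := eulerProd 1 ^ (3 * b))
    (V := eulerProd 2 ^ b) hp.out.not_dvd_one (constantCoeff_eulerProd_pow one_pos _) ?_
    (residuePart_sqNat_eq_zero hr) hn
  have e1 : 3 * b * p = 3 * k + 1 + 2 := by linarith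
  have e2 : b * p = k + 1 := by linarith
  rw [← pow_mul, ← pow_mul, e1, e2, pow_add, pow_succ (eulerProd 2) k, Nat.cast_one, one_mul]
  linear_combination eulerProd 1 ^ 2 * diamondSeries_mul k - eulerProd 2 ^ k * thetaSeries_sqNat_mul

/-- For `k ≡ -2 (mod p)` the generating function is `f₁⁵ / f₂²`, up to `p`-th powers. -/
theorem modEq_zero_of_pentagonalNeg {p k b r n : ℕ} [hp : Fact p.Prime] (hk : k + 2 = p * b)
    (hr : ∀ x : ZMod p, 2 * r = x * (3 * x + 1) → 6 * x + 1 = 0) (hn : n % p = r) :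
    elongatedDiamondCount k n ≡ 0 [MOD p] := by
  refine elongatedDiamondCount_modEq_zero (c := 1) (U := eulerProd 1 ^ (3 * b))
    (V := eulerProd 2 ^ b) hp.out.not_dvd_one (constantCoeff_eulerProd_pow one_pos _) ?_
    (residuePart_pentagonalNeg_eq_zero hr) hn
  have e1 : 3 * b * p = 3 * k + 1 + 5 := by linarith
  have e2 : b * p = k + 2 := by linarith
  rw [← pow_mul, ← pow_mul, e1, e2, pow_add, pow_add, Nat.cast_one, one_mul]
  linear_combination eulerProd 1 ^ 5 * diamondSeries_mul k -
    eulerProd 2 ^ k * thetaSeries_pentagonalNeg_linear_mul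

theorem modEq_zero_two {j n : ℕ} (hn : n % 2 = 1) :
    elongatedDiamondCount (2 * j + 1) n ≡ 0 [MOD 2] := by
  have h := diamondSeries_mul (2 * j + 1)
  refine elongatedDiamondCount_modEq_zero (c := 1) (F := eulerProd 2)
    (U := eulerProd 1 ^ (3 * j + 2))
    (V := eulerProd 2 ^ j) (by norm_num) (constantCoeff_eulerProd_pow one_pos _)
    (by push_cast; linear_combination h) ?_ hn
  rw [residuePart_eq_zero_iff, ← mul_one 2, ← expand_eulerProd two_ne_zero one_pos,
    reduceMod_expand]
  exact fun m hm => coeff_expand_of_not_dvd _ _ _ (by omega)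

theorem modEq_zero_three {j n : ℕ} (hn : n % 3 = 2) :
    elongatedDiamondCount (3 * j + 2) n ≡ 0 [MOD 3] := by
  have h := diamondSeries_mul (3 * j + 2)
  refine elongatedDiamondCount_modEq_zero (c := 2) (U := eulerProd 1 ^ (3 * j + 2))
    (F := thetaSeries triangular fun _ => 1)
    (V := eulerProd 2 ^ j) (by norm_num) (constantCoeff_eulerProd_pow one_pos _) ?_ ?_ hn
  · refine mul_right_cancel₀ eulerProd_one_ne_zero ?_
    push_cast
    linear_combination 2 * h - eulerProd 2 ^ (3 * j) * thetaSeries_triangular_mul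
  · refine residuePart_triangular_eq_zero fun i hi => absurd hi ?_
    generalize (i : ZMod 3) = x
    revert x
    decide

theorem modEq_zero_five_three {j n r : ℕ} (hn : n % 5 = r) (hr : r ∈ ({1, 3, 4} : Set ℕ)) :
    elongatedDiamondCount (5 * j + 3) n ≡ 0 [MOD 5] := by
  have h := diamondSeries_mul (5 * j + 3)
  have hJ := congrArg (expand 2 two_ne_zero) thetaSeries_triangular_cube
  rw [map_mul, map_pow, map_ofNat, expand_eulerProd _ one_pos, mul_one, expand_thetaSeries] at hJ
  refine elongatedDiamondCount_modEq_zero (c := 2) (U := eulerProd 1 ^ (3 * j + 2))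
    (F := thetaSeries (fun j => 2 * triangular j) fun j => altSign j * (2 * j + 1))
    (V := eulerProd 2 ^ j) (by norm_num) (constantCoeff_eulerProd_pow one_pos _) ?_ ?_ hn
  · push_cast
    linear_combination 2 * h - eulerProd 2 ^ (5 * j) * hJ
  · refine residuePart_thetaSeries_eq_zero (finiteFibers_triangular.const_mul two_ne_zero)
      fun i hi => ?_
    have h2 := congrArg (Int.cast : ℤ → ZMod 5) (two_mul_triangular i)
    push_cast at h2 hi ⊢
    rw [h2] at hi
    have key : ∀ x : ZMod 5, x * (x + 1) = r → 2 * x + 1 = 0 := by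
      rcases hr with rfl | rfl | rfl <;> decide
    rw [key _ hi, mul_zero]

/-- Modulo `5`, the partition generating function is `f₁ f₁³`, up to fifth powers. -/
theorem modEq_zero_five_five {j n : ℕ} (hn : n % 5 = 4) :
    elongatedDiamondCount (5 * j + 5) n ≡ 0 [MOD 5] := by
  have h := diamondSeries_mul (5 * j + 5)
  have hF := thetaSeries_mul finiteFibers_pentagonalNeg finiteFibers_triangular altSign
    fun j => altSign j * (2 * j + 1)
  rw [thetaSeries_pentagonalNeg, thetaSeries_triangular_cube] at hF
  refine elongatedDiamondCount_modEq_zero (c := 2) (U := eulerProd 1 ^ (3 * j + 4))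
    (V := eulerProd 2 ^ (j + 1)) (by norm_num) (constantCoeff_eulerProd_pow one_pos _)
    (F := eulerProd 1 * (2 * eulerProd 1 ^ 3)) ?_ ?_ hn
  · push_cast
    linear_combination 2 * eulerProd 1 ^ 4 * h
  · rw [hF]
    refine residuePart_thetaSeries_eq_zero
      (finiteFibers_pentagonalNeg.prod finiteFibers_triangular) fun i hi => ?_
    have h1 := congrArg (Int.cast : ℤ → ZMod 5) (two_mul_pentagonalNeg i.1)
    have h2 := congrArg (Int.cast : ℤ → ZMod 5) (two_mul_triangular i.2)
    push_cast at h1 h2 hi ⊢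
    have key : ∀ x y : ZMod 5, x * (3 * x + 1) + y * (y + 1) = 2 * 4 → 2 * y + 1 = 0 := by decide
    rw [key i.1 i.2 (by rw [← hi, ← h1, ← h2]; ring)]
    ring

theorem modEq_zero_seven_five {j n r : ℕ} (hn : n % 7 = r) (hr : r ∈ ({2, 3, 4, 6} : Set ℕ)) :
    elongatedDiamondCount (7 * j + 5) n ≡ 0 [MOD 7] := by
  have h := diamondSeries_mul (7 * j + 5)
  refine elongatedDiamondCount_modEq_zero (c := 1) (U := eulerProd 1 ^ (3 * j + 2))
    (F := thetaSeries octagonal fun m => altSign m * (3 * m + 1))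
    (V := eulerProd 2 ^ j) (by norm_num) (constantCoeff_eulerProd_pow one_pos _) ?_ ?_ hn
  · refine mul_right_cancel₀ (pow_ne_zero 2 eulerProd_one_ne_zero) ?_
    push_cast
    linear_combination h - eulerProd 2 ^ (7 * j) * thetaSeries_octagonal_linear_mul
  · refine residuePart_thetaSeries_eq_zero finiteFibers_octagonal fun i hi => ?_
    rw [natCast_octagonal] at hi
    push_cast at hi ⊢
    have key : ∀ x : ZMod 7, x * (3 * x + 2) = r → 3 * x + 1 = 0 := by
      rcases hr with rfl | rfl | rfl | rfl <;> decide
    rw [key _ hi, mul_zero]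

/-- Modulo `7`, the partition generating function is `(f₁³)²`, up to seventh powers. -/
theorem modEq_zero_seven_seven {j n : ℕ} (hn : n % 7 = 5) :
    elongatedDiamondCount (7 * j + 7) n ≡ 0 [MOD 7] := by
  have h := diamondSeries_mul (7 * j + 7)
  have hF := thetaSeries_mul finiteFibers_triangular finiteFibers_triangular
    (fun j => altSign j * (2 * j + 1)) fun j => altSign j * (2 * j + 1)
  rw [thetaSeries_triangular_cube] at hF
  refine elongatedDiamondCount_modEq_zero (c := 4) (U := eulerProd 1 ^ (3 * j + 4))
    (V := eulerProd 2 ^ (j + 1)) (by norm_num) (constantCoeff_eulerProd_pow one_pos _)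
    (F := 2 * eulerProd 1 ^ 3 * (2 * eulerProd 1 ^ 3)) ?_ ?_ hn
  · push_cast
    linear_combination 4 * eulerProd 1 ^ 6 * h
  · rw [hF]
    refine residuePart_thetaSeries_eq_zero
      (finiteFibers_triangular.prod finiteFibers_triangular) fun i hi => ?_
    have h1 := congrArg (Int.cast : ℤ → ZMod 7) (two_mul_triangular i.1)
    have h2 := congrArg (Int.cast : ℤ → ZMod 7) (two_mul_triangular i.2)
    push_cast at h1 h2 hi ⊢
    have key : ∀ x y : ZMod 7, x * (x + 1) + y * (y + 1) = 2 * 5 → 2 * y + 1 = 0 := by decide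
    rw [key i.1 i.2 (by rw [← hi, ← h1, ← h2]; ring)]
    ring

theorem residuePart_sub {R : Type*} [CommRing R] (p r : ℕ) (F G : R⟦X⟧) :
    residuePart p r (F - G) = residuePart p r F - residuePart p r G := by
  ext n
  simp only [coeff_residuePart, map_sub]
  split_ifs <;> simp

/-- The exponent condition says that a sum of two squares vanishes modulo `11`; since `-1` is not a
square, both squares vanish, and with them the weights. -/
theorem modEq_zero_eleven_two {j n : ℕ} (hn : n % 11 = 7) :
    elongatedDiamondCount (11 * j + 2) n ≡ 0 [MOD 11] := by
  have h := diamondSeries_mul (11 * j + 2)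
  refine elongatedDiamondCount_modEq_zero (c := 1) (U := eulerProd 1 ^ (3 * j + 1))
    (F := eulerProd 1 ^ 4 * eulerProd 2 ^ 2)
    (V := eulerProd 2 ^ j) (by norm_num) (constantCoeff_eulerProd_pow one_pos _) ?_ ?_ hn
  · push_cast
    linear_combination eulerProd 1 ^ 4 * h
  · have hP := finiteFibers_pentagonalNeg.const_mul four_ne_zero
    have hO := finiteFibers_octagonal.const_mul two_ne_zero
    have e1 : (4 : ℤ⟦X⟧) * X * thetaSeries (fun i => 2 * octagonal i) (fun m => 3 * m + 1) ^ 2 =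
        thetaSeries (fun p : ℤ × ℤ => 1 + (2 * octagonal p.1 + 2 * octagonal p.2))
          fun p => 4 * ((3 * p.1 + 1) * (3 * p.2 + 1)) := by
      rw [← X_pow_mul_thetaSeries, thetaSeries_const_mul (hO.prod hO),
        ← thetaSeries_mul hO hO (fun m => 3 * m + 1) fun m => 3 * m + 1, map_ofNat]
      ring
    have hX : FiniteFibers fun p : ℤ × ℤ => 1 + (2 * octagonal p.1 + 2 * octagonal p.2) :=
      fun n => ((hO.prod hO) n).subset fun p hp => by
        simp only [Set.mem_ofPred_eq] at hp ⊢
        omega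
    rw [eulerProd_four_two, expand_thetaSeries, expand_thetaSeries, e1, sq, thetaSeries_mul hP hP,
      map_sub, residuePart_sub, residuePart_thetaSeries_eq_zero (hP.prod hP),
      residuePart_thetaSeries_eq_zero hX, sub_zero]
    · intro i hi
      have h1 := natCast_octagonal i.1
      have h2 := natCast_octagonal i.2
      push_cast at hi ⊢
      have key : ∀ x y : ZMod 11, 1 + (2 * (x * (3 * x + 2)) + 2 * (y * (3 * y + 2))) = 7 →
          3 * x + 1 = 0 := by decide
      rw [key i.1 i.2]
      · ring
      · have h1' := congrArg (Int.cast : ℤ → ZMod 11) h1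
        have h2' := congrArg (Int.cast : ℤ → ZMod 11) h2
        push_cast at h1' h2'
        rw [← h1', ← h2', hi]
    · intro i hi
      have h1 := congrArg (Int.cast : ℤ → ZMod 11) (two_mul_pentagonalNeg i.1)
      have h2 := congrArg (Int.cast : ℤ → ZMod 11) (two_mul_pentagonalNeg i.2)
      push_cast at hi h1 h2 ⊢
      have key : ∀ x y : ZMod 11, 2 * (x * (3 * x + 1)) + 2 * (y * (3 * y + 1)) = 7 →
          6 * x + 1 = 0 := by decide
      rw [key i.1 i.2]
      · ring
      · rw [← h1, ← h2, ← hi]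
        ring

/-- Modulo `11`, write `f₁³ = a + b + c + d + e` with the exponents in the residue classes
`0, 1, 3, 6, 10`. The fourth power of this is `f₁`, up to eleventh powers, so that it has no
exponents in the classes `3, 6, 8, 9, 10`. These five quartic relations generate an ideal that
contains the part of the seventh power with exponents in the class `6`. -/
theorem residuePart_cube_pow_seven :
    residuePart 11 6 (reduceMod 11
      (thetaSeries triangular fun j => altSign j * (2 * j + 1)) ^ 7) = 0 := by
  have hJ : ∀ r : ℕ, (∀ x : ZMod 11, 2 * r = x * (x + 1) → 2 * x + 1 = 0) →
      residuePart 11 r (reduceMod 11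
        (thetaSeries triangular fun j => altSign j * (2 * j + 1))) = 0 := fun r hr =>
    residuePart_triangular_eq_zero fun i hi => by
      push_cast
      rw [hr _ hi, mul_zero]
  have h4 : ∀ r : ℕ, (∀ x : ZMod 11, 2 * r ≠ x * (3 * x + 1)) → residuePart 11 r (reduceMod 11
      (thetaSeries triangular fun j => altSign j * (2 * j + 1)) ^ 4) = 0 := by
    intro r hr
    refine residuePart_eq_zero_of_mul_pow (U := 1) (V := reduceMod 11 (eulerProd 1))
      (B := reduceMod 11 (thetaSeries pentagonalNeg fun j => 16 * altSign j)) (map_one _) ?_ ?_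
    · rw [thetaSeries_const_mul finiteFibers_pentagonalNeg, thetaSeries_triangular_cube,
        thetaSeries_pentagonalNeg, ← map_pow, ← map_pow, ← map_mul, map_ofNat, one_pow, mul_one]
      congr 1
      ring
    · refine residuePart_thetaSeries_eq_zero finiteFibers_pentagonalNeg fun i hi => ?_
      have h1 := congrArg (Int.cast : ℤ → ZMod 11) (two_mul_pentagonalNeg i)
      push_cast at hi h1
      exact absurd (by rw [← h1, hi]) (hr i)
  generalize reduceMod 11 (thetaSeries triangular fun j => altSign j * (2 * j + 1)) = J at *
  have z2 := hJ 2 (by decide)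
  have z4 := hJ 4 (by decide)
  have z5 := hJ 5 (by decide)
  have z7 := hJ 7 (by decide)
  have z8 := hJ 8 (by decide)
  have z9 := hJ 9 (by decide)
  have r3 := h4 3 (by decide)
  have r6 := h4 6 (by decide)
  have r8 := h4 8 (by decide)
  have r9 := h4 9 (by decide)
  have r10 := h4 10 (by decide)
  have hmul : ∀ {r : ℕ}, r < 11 → ∀ F G : (ZMod 11)⟦X⟧, residuePart 11 r (F * G) =
      ∑ s ∈ Finset.range 11, residuePart 11 s F * residuePart 11 ((r + 11 - s) % 11) G :=
    residuePart_mul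
  rw [show J ^ 4 = J * J * (J * J) by ring] at r3 r6 r8 r9 r10
  rw [show J ^ 7 = J * J * (J * J) * (J * J * J) by ring]
  simp (disch := norm_num) only [hmul, Finset.sum_range_succ, Finset.sum_range_zero, Nat.reduceAdd,
    Nat.reduceSub, Nat.reduceMod, z2, z4, z5, z7, z8, z9, mul_zero, zero_mul, add_zero, zero_add]
    at r3 r6 r8 r9 r10 ⊢
  generalize residuePart 11 0 J = a at *
  generalize residuePart 11 1 J = b at *
  generalize residuePart 11 3 J = c at *
  generalize residuePart 11 6 J = d at *
  generalize residuePart 11 10 J = e at *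
  have h11 : (11 : (ZMod 11)⟦X⟧) = 0 := by
    rw [← map_ofNat (C (R := ZMod 11)) 11, show (11 : ZMod 11) = 0 from rfl, map_zero]
  -- the last summand collects the coefficients that are divisible by `11`
  linear_combination (4 * a ^ 2 * c - b ^ 3 - b * c * e) * r3 +
    (4 * d ^ 2 * e - a ^ 3 - a * b * e) * r6 + (4 * a * e ^ 2 - c ^ 3 - a * c * d) * r8 +
    (4 * b ^ 2 * d - e ^ 3 - c * d * e) * r9 + (4 * b * c ^ 2 - d ^ 3 - a * b * d) * r10 +
    (a ^ 6 * d + a ^ 5 * c ^ 2 + 22 * a ^ 4 * b * d * e + 12 * a ^ 3 * b ^ 3 * c + 30 * a ^ 3 *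
      b * c ^ 2 * e + 12 * a ^ 3 * d ^ 3 * e + 54 * a ^ 2 * b ^ 2 * c * d ^ 2 + 54 * a ^ 2 * b ^ 2
      * d * e ^ 2 + 54 * a ^ 2 * c ^ 2 * d ^ 2 * e + 30 * a ^ 2 * c * d * e ^ 3 + a ^ 2 * e ^ 5 +
      a * b ^ 6 + 22 * a * b ^ 4 * c * e + 30 * a * b ^ 2 * c ^ 3 * d + 54 * a * b ^ 2 * c ^ 2 * e
      ^ 2 + 22 * a * b * c * d ^ 4 + 30 * a * b * d ^ 3 * e ^ 2 + 22 * a * c ^ 4 * d * e + 12 * a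
      * c ^ 3 * e ^ 3 + b ^ 5 * d ^ 2 + 30 * b ^ 3 * c * d ^ 2 * e + 12 * b ^ 3 * d * e ^ 3 + b ^
      2 * c ^ 5 + 12 * b * c ^ 3 * d ^ 3 + 54 * b * c ^ 2 * d ^ 2 * e ^ 2 + 22 * b * c * d * e ^ 4
      + b * e ^ 6 + c ^ 6 * e + c * d ^ 6 + d ^ 5 * e ^ 2) * h11

/-- Modulo `11`, the partition generating function is `(f₁³)⁷`, up to eleventh powers. -/
theorem modEq_zero_eleven_eleven {j n : ℕ} (hn : n % 11 = 6) :
    elongatedDiamondCount (11 * j + 11) n ≡ 0 [MOD 11] := by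
  have h := diamondSeries_mul (11 * j + 11)
  refine elongatedDiamondCount_modEq_zero (c := 128) (U := eulerProd 1 ^ (3 * j + 5))
    (V := eulerProd 2 ^ (j + 1)) (by norm_num) (constantCoeff_eulerProd_pow one_pos _) ?_
    (F := thetaSeries triangular (fun j => altSign j * (2 * j + 1)) ^ 7)
    (by rw [map_pow]; exact residuePart_cube_pow_seven) hn
  rw [thetaSeries_triangular_cube]
  push_cast
  linear_combination 128 * eulerProd 1 ^ 21 * h

end Congruences

end DiamondCongruences

theorem corollary4p5 (j n : ℕ) :
    (elongatedDiamondCount (2 * j + 1) (2 * n + 1) ≡ 0 [MOD 2]) ∧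
    (elongatedDiamondCount (3 * j + 2) (3 * n + 2) ≡ 0 [MOD 3]) ∧
    (∀ b ∈ ({1, 3, 4} : Set ℕ), elongatedDiamondCount (5 * j + 3) (5 * n + b) ≡ 0 [MOD 5]) ∧
    (∀ b ∈ ({2, 3} : Set ℕ), elongatedDiamondCount (5 * j + 4) (5 * n + b) ≡ 0 [MOD 5]) ∧
    (elongatedDiamondCount (5 * j + 5) (5 * n + 4) ≡ 0 [MOD 5]) ∧
    (∀ b ∈ ({2, 3, 4, 6} : Set ℕ), elongatedDiamondCount (7 * j + 5) (7 * n + b) ≡ 0 [MOD 7]) ∧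
    (∀ b ∈ ({3, 5, 6} : Set ℕ), elongatedDiamondCount (7 * j + 6) (7 * n + b) ≡ 0 [MOD 7]) ∧
    (elongatedDiamondCount (7 * j + 7) (7 * n + 5) ≡ 0 [MOD 7]) ∧
    (elongatedDiamondCount (11 * j + 2) (11 * n + 7) ≡ 0 [MOD 11]) ∧
    (∀ b ∈ ({3, 5, 6, 8, 9, 10} : Set ℕ),
      elongatedDiamondCount (11 * j + 9) (11 * n + b) ≡ 0 [MOD 11]) ∧
    (∀ b ∈ ({2, 6, 7, 8, 10} : Set ℕ),
      elongatedDiamondCount (11 * j + 10) (11 * n + b) ≡ 0 [MOD 11]) ∧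
    (elongatedDiamondCount (11 * j + 11) (11 * n + 6) ≡ 0 [MOD 11]) ∧
    (∀ b ∈ ({3, 4, 6, 7, 8, 10, 11} : Set ℕ),
      elongatedDiamondCount (13 * j + 11) (13 * n + b) ≡ 0 [MOD 13]) ∧
    (∀ b ∈ ({2, 5, 6, 7, 8, 11} : Set ℕ),
      elongatedDiamondCount (13 * j + 12) (13 * n + b) ≡ 0 [MOD 13]) := by
  refine ⟨modEq_zero_two (by omega), modEq_zero_three (by omega), fun b hb => ?_, fun b hb => ?_,
    modEq_zero_five_five (by omega), fun b hb => ?_, fun b hb => ?_, modEq_zero_seven_seven (by omega),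
    modEq_zero_eleven_two (by omega), fun b hb => ?_, fun b hb => ?_, modEq_zero_eleven_eleven (by omega),
    fun b hb => ?_, fun b hb => ?_⟩
  · refine modEq_zero_five_three (r := b) ?_ hb
    rcases hb with rfl | rfl | rfl <;> omega
  · rcases hb with rfl | rfl <;>
      exact modEq_zero_of_sqNat (b := j + 1) (by ring) (by decide) (Nat.mul_add_mod _ _ _)
  · refine modEq_zero_seven_five (r := b) ?_ hb
    rcases hb with rfl | rfl | rfl | rfl <;> omega
  · rcases hb with rfl | rfl | rfl <;>
      exact modEq_zero_of_sqNat (b := j + 1) (by ring) (by decide) (Nat.mul_add_mod _ _ _)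
  · rcases hb with rfl | rfl | rfl | rfl | rfl | rfl <;>
      exact modEq_zero_of_pentagonalNeg (b := j + 1) (by ring) (by decide) (Nat.mul_add_mod _ _ _)
  · rcases hb with rfl | rfl | rfl | rfl | rfl <;>
      exact modEq_zero_of_sqNat (b := j + 1) (by ring) (by decide) (Nat.mul_add_mod _ _ _)
  · rcases hb with rfl | rfl | rfl | rfl | rfl | rfl | rfl <;>
      exact modEq_zero_of_pentagonalNeg (b := j + 1) (by ring) (by decide) (Nat.mul_add_mod _ _ _)
  · rcases hb with rfl | rfl | rfl | rfl | rfl | rfl <;>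
      exact modEq_zero_of_sqNat (b := j + 1) (by ring) (by decide) (Nat.mul_add_mod _ _ _)
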